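/- Let $L,N,m_1,m_2$ be integers with $1<m_1<L$, $1\le m_2<N$ and $m_1/L+m_2/N<1$, let $q\in[0,1)$ and $a_1,\dots,a_N>0$. Consider sets of occupied sites (particles) of the torus $\mathbb Z/L\times\mathbb Z/N$ (horizontal coordinate, row; rows cyclically labelled $1,\dots,N$ upwards) with exactly $m_1$ particles on each row. For a particle $p$ with horizontal position $x_p$ on row $r(p)$, let $p_1,p_4$ be the next particles to its right and left on the same row. Assume interlacing: for every $p$, row $r(p)-1$ contains exactly one particle $p_2$ with $x_{p_2}\in\{x_p+1,\dots,x_{p_1}\}$ and exactly one particle $p_3$ with $x_{p_3}\in\{x_{p_4}+1,\dots,x_p\}$; then row $r(p)+1$ contains exactly one particle $p_6$ with $x_{p_6}\in\{x_p,\dots,x_{p_1}-1\}$. Put $$A_p=x_{p_1}-x_p-1,\quad B_p=x_{p_2}-x_p-1,\quad C_p=x_p-x_{p_3},\quad D_p=x_p-x_{p_4}-1,\quad F_p=x_{p_6}-x_p,$$ the distances being measured along these intervals. The loop $p\to p_6\to (p_6)_6\to\cdots\to p$ has horizontal and vertical winding numbers $N_h,N_v$, which do not depend on the starting particle $p$.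 Let $\Omega=\Omega_{L,N;m_1,m_2}$ be the set of interlacing configurations with $m_1N_h/N_v=m_2$. On $\Omega$ consider the probability law $$\pi(\sigma)=\frac1Z\prod_{p}a_{r(p)}^{C_p}\,\frac{(q;q)_{A_p}}{(q;q)_{B_p}(q;q)_{C_p}},\qquad (q;q)_n=\prod_{k=1}^n(1-q^k),$$ and the continuous-time Markov chain in which, for each particle $p$, the family $V_p^+$ is shifted one site to the right at rate $$a_{r(p)}\,\frac{(1-q^{B_p})(1-q^{D_p+1})}{1-q^{C_p+1}}\qquad(q^0=1\text{ also for }q=0),$$ where $V_p^+$ consists of $p$ and of all particles reachable from $p$ by steps $r\to r_6$ from particles $r$ with $F_r=0$. Then $\Omega$ is non-empty, so that $\pi$ is a well-defined probability law; all moves of positive rate from a configuration in $\Omega$ lead to a configuration in $\Omega$, so that the chain is well defined on $\Omega$; and $\pi$ is stationary: if $P_t=e^{t\mathcal L}$ is the transition semigroup of the chain, with generator $\mathcal L$, then $\pi P_t=\pi$ for every $t\ge0$. -/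

import Mathlib

namespace QWhittaker

/-- Sites of the discrete torus: horizontal coordinate in `ℤ/L`, row in `ℤ/N`. -/
abbrev Site (L N : ℕ) : Type := ZMod L × ZMod N

section Geometry

variable {L N : ℕ}

/-- `A_p`: empty sites strictly between `p` and the next particle to its right on the same row. -/
noncomputable def gapA (η : Finset (Site L N)) (p : Site L N) : ℕ :=
  sInf {n : ℕ | (p.1 + (n : ZMod L) + 1, p.2) ∈ η}

/-- `B_p = x_{p₂} - x_p - 1`, with `p₂` the first particle of the row below strictly to the right
of `p`. -/
noncomputable def gapB (η : Finset (Site L N)) (p : Site L N) : ℕ :=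
  sInf {n : ℕ | (p.1 + (n : ZMod L) + 1, p.2 - 1) ∈ η}

/-- `C_p = x_p - x_{p₃}`, with `p₃` the first particle of the row below weakly to the left
of `p`. -/
noncomputable def gapC (η : Finset (Site L N)) (p : Site L N) : ℕ :=
  sInf {n : ℕ | (p.1 - (n : ZMod L), p.2 - 1) ∈ η}

/-- `D_p`: empty sites strictly between `p` and the next particle to its left on the same row. -/
noncomputable def gapD (η : Finset (Site L N)) (p : Site L N) : ℕ :=
  sInf {n : ℕ | (p.1 - (n : ZMod L) - 1, p.2) ∈ η}

/-- `F_p = x_{p₆} - x_p`, with `p₆` the first particle of the row above weakly to the right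
of `p`. -/
noncomputable def gapF (η : Finset (Site L N)) (p : Site L N) : ℕ :=
  sInf {n : ℕ | (p.1 + (n : ZMod L), p.2 + 1) ∈ η}

/-- For each particle `p`, with right and left neighbours `p₁, p₄` on its row, the row below has
exactly one particle in `{x_p + 1, …, x_{p₁}}` and exactly one in `{x_{p₄} + 1, …, x_p}`. -/
def Interlacing (η : Finset (Site L N)) : Prop :=
  ∀ p ∈ η,
    (∃! k : ℕ, (1 ≤ k ∧ k ≤ gapA η p + 1) ∧ (p.1 + (k : ZMod L), p.2 - 1) ∈ η) ∧
    (∃! k : ℕ, k ≤ gapD η p ∧ (p.1 - (k : ZMod L), p.2 - 1) ∈ η)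

/-- The up-right neighbour `p₆` of `p`. -/
noncomputable def upRight (η : Finset (Site L N)) (p : Site L N) : Site L N :=
  (p.1 + (gapF η p : ZMod L), p.2 + 1)

/-- Number of steps of the path `Γ : p, p₆, (p₆)₆, …` until it first returns to `p`. -/
noncomputable def loopLength (η : Finset (Site L N)) (p : Site L N) : ℕ :=
  Function.minimalPeriod (upRight η) p

/-- Vertical winding number of `Γ`: its total vertical displacement (one per step) over `N`. -/
noncomputable def windV (η : Finset (Site L N)) (p : Site L N) : ℕ :=
  loopLength η p / N

/-- Horizontal winding number of `Γ`: its total horizontal displacement (the sum of the `F`'s of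
the visited particles) over `L`. -/
noncomputable def windH (η : Finset (Site L N)) (p : Site L N) : ℕ :=
  (∑ k ∈ Finset.range (loopLength η p), gapF η ((upRight η)^[k] p)) / L

/-- Membership in the sector `Ω_{L,N;m₁,m₂}`: `m₁` particles on each row, interlacing, and
`m₂ = m₁ N_h / N_v`. -/
def IsConfig (m₁ m₂ : ℕ) (η : Finset (Site L N)) : Prop :=
  (∀ i : ZMod N, (η.filter (fun p => p.2 = i)).card = m₁) ∧
  Interlacing η ∧
  ∀ p ∈ η, (m₂ : ℚ) = (m₁ : ℚ) * ((windH η p : ℚ) / (windV η p : ℚ))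

/-- Directed upward edge from a particle `r` to its up-right neighbour, drawn when `F_r = 0`. -/
def UpEdge (η : Finset (Site L N)) (r s : Site L N) : Prop :=
  r ∈ η ∧ gapF η r = 0 ∧ s = upRight η r

open Classical in
/-- `V⁺_p`: `p` and all particles reachable from `p` along upward edges. -/
noncomputable def family (η : Finset (Site L N)) (p : Site L N) : Finset (Site L N) :=
  η.filter (fun s => Relation.ReflTransGen (UpEdge η) p s)

/-- The occupied sites after all particles of `V⁺_p` have moved one site to the right. -/
noncomputable def shift (η : Finset (Site L N)) (p : Site L N) : Finset (Site L N) :=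
  (η \ family η p) ∪ (family η p).image (fun s => (s.1 + 1, s.2))

/-- The rate at which `V⁺_p` is shifted to the right. -/
noncomputable def rate (q : ℝ) (a : ZMod N → ℝ) (η : Finset (Site L N)) (p : Site L N) : ℝ :=
  a p.2 * ((1 - q ^ gapB η p) * (1 - q ^ (gapD η p + 1)) / (1 - q ^ (gapC η p + 1)))

/-- `(q;q)_n = (1 - q)(1 - q²)⋯(1 - qⁿ)`. -/
noncomputable def qPoch (q : ℝ) (n : ℕ) : ℝ := ∏ k ∈ Finset.range n, (1 - q ^ (k + 1))

/-- The unnormalized Gibbs weight. -/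
noncomputable def weight (q : ℝ) (a : ZMod N → ℝ) (η : Finset (Site L N)) : ℝ :=
  ∏ p ∈ η, a p.2 ^ gapC η p *
    (qPoch q (gapA η p) / (qPoch q (gapB η p) * qPoch q (gapC η p)))

end Geometry

/-- The state space `Ω_{L,N;m₁,m₂}`. -/
abbrev Config (L N m₁ m₂ : ℕ) : Type := {η : Finset (Site L N) // IsConfig m₁ m₂ η}

noncomputable instance instFintypeConfig (L N m₁ m₂ : ℕ) [NeZero L] [NeZero N] :
    Fintype (Config L N m₁ m₂) :=
  Fintype.ofFinite _

section Dynamics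

variable (L N m₁ m₂ : ℕ) [NeZero L] [NeZero N] (q : ℝ) (a : ZMod N → ℝ)

/-- The Gibbs measure on `Ω_{L,N;m₁,m₂}`, as its vector of point masses. -/
noncomputable def gibbs (σ : Config L N m₁ m₂) : ℝ :=
  weight q a σ.1 / ∑ τ : Config L N m₁ m₂, weight q a τ.1

/-- The generator of the dynamics, `(𝓛 f)(σ) = ∑_p rate_p(σ) (f(σ shifted along V⁺_p) - f(σ))`,
as a matrix on `Ω_{L,N;m₁,m₂}`. The diagonal holds minus the full exit rate, so the row sums
vanish exactly when no move leaves the state space. -/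
noncomputable def generator : Matrix (Config L N m₁ m₂) (Config L N m₁ m₂) ℝ :=
  fun σ η => ∑ p ∈ σ.1,
    rate q a σ.1 p * ((if shift σ.1 p = η.1 then 1 else 0) - (if σ = η then 1 else 0))

/-- The transition semigroup `P_t = exp (t 𝓛)` of the continuous-time Markov chain. -/
noncomputable def semigroup (t : ℝ) : Matrix (Config L N m₁ m₂) (Config L N m₁ m₂) ℝ :=
  NormedSpace.exp (t • generator L N m₁ m₂ q a)

end Dynamics

end QWhittaker

namespace QWhittaker

/-- `E_p`: empty sites between `p` and the first particle of the row above strictly to the left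
of `p`. -/
noncomputable def gapE {L N : ℕ} (η : Finset (Site L N)) (p : Site L N) : ℕ :=
  sInf {n : ℕ | (p.1 - (n : ZMod L) - 1, p.2 + 1) ∈ η}

/-- The site of the particle with label `k` on row `i` of a labelled configuration on `ℤ × ℤ`. -/
def site (L N : ℕ) (x : ℕ → ℤ → ℤ) (i : ℕ) (k : ℤ) : Site L N :=
  ((x i k : ZMod L), (i : ZMod N))

/-- `x` enumerates the particles of the lift of `η` to the universal cover, row by row, in such a
way that the up-right neighbour of a particle carries the same label. -/
structure IsLift {L N : ℕ} (m₁ m₂ : ℕ) (η : Finset (Site L N)) (x : ℕ → ℤ → ℤ) : Prop where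
  le_up : ∀ i k, x i k ≤ x (i + 1) k
  up_lt : ∀ i k, x (i + 1) k < x i (k + 1)
  add_label : ∀ i k, x i (k + m₁) = x i k + L
  add_row : ∀ i k, x (i + N) k = x i (k + m₂)
  mem : ∀ (i : ℕ) (y : ℤ), ((y : ZMod L), (i : ZMod N)) ∈ η ↔ ∃ k, x i k = y

lemma sInf_eq_of_forall_lt {P : ℕ → Prop} {m : ℕ} (hm : P m) (h : ∀ n < m, ¬ P n) :
    sInf {n | P n} = m := by
  refine le_antisymm (Nat.sInf_le hm) ?_
  by_contra hlt
  exact h _ (not_le.mp hlt) (Nat.sInf_mem (s := {n | P n}) ⟨m, hm⟩)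

lemma add_mul_of_add_eq {m l : ℤ} {f : ℤ → ℤ} (hf : ∀ k, f (k + m) = f k + l) (k c : ℤ) :
    f (k + c * m) = f k + c * l := by
  induction c using Int.induction_on with
  | zero => simp
  | succ c ih =>
    rw [show k + ((c : ℤ) + 1) * m = k + c * m + m by ring, hf, ih]
    ring
  | pred c ih =>
    have := hf (k + (-(c : ℤ) - 1) * m)
    rw [show k + (-(c : ℤ) - 1) * m + m = k + -(c : ℤ) * m by ring, ih] at this
    linarith

lemma row_add_mul_of_add {N : ℕ} {m : ℤ} {x : ℕ → ℤ → ℤ}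
    (hx : ∀ i k, x (i + N) k = x i (k + m)) (i : ℕ) (k : ℤ) (c : ℕ) :
    x (i + N * c) k = x i (k + c * m) := by
  induction c generalizing k with
  | zero => simp
  | succ c ih =>
    rw [show i + N * (c + 1) = i + N * c + N by ring, hx, ih]
    congr 1; push_cast; ring

section Lift

variable {L N m₁ m₂ : ℕ} {η : Finset (Site L N)} {x : ℕ → ℤ → ℤ}

namespace IsLift

lemma strictMono (h : IsLift m₁ m₂ η x) (i : ℕ) : StrictMono (x i) :=
  strictMono_int_of_lt_succ fun k => (h.le_up i k).trans_lt (h.up_lt i k)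

lemma lt_succ (h : IsLift m₁ m₂ η x) (i : ℕ) (k : ℤ) : x i k < x i (k + 1) :=
  h.strictMono i (lt_add_one k)

lemma site_mem (h : IsLift m₁ m₂ η x) (i : ℕ) (k : ℤ) : site L N x i k ∈ η :=
  (h.mem i _).2 ⟨k, rfl⟩

lemma not_mem_of_lt_of_lt (h : IsLift m₁ m₂ η x) {i : ℕ} {k y : ℤ} (h₁ : x i k < y)
    (h₂ : y < x i (k + 1)) : ((y : ZMod L), (i : ZMod N)) ∉ η := by
  rw [h.mem]
  rintro ⟨j, rfl⟩
  have := (h.strictMono i).lt_iff_lt.1 h₁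
  have := (h.strictMono i).lt_iff_lt.1 h₂
  omega

lemma exists_site_succ [NeZero N] (h : IsLift m₁ m₂ η x) {p : Site L N} (hp : p ∈ η) :
    ∃ i k, p = site L N x (i + 1) k := by
  obtain ⟨c, r⟩ := p
  obtain ⟨y, rfl⟩ := ZMod.intCast_surjective c
  obtain ⟨i, rfl⟩ : ∃ i : ℕ, r = ((i + 1 : ℕ) : ZMod N) := by
    refine ⟨(r - 1).val, ?_⟩
    push_cast
    rw [ZMod.natCast_zmod_val]
    ring
  obtain ⟨k, hk⟩ := (h.mem _ _).1 hp
  exact ⟨i, k, by simp [site, hk]⟩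

lemma add_label_mul (h : IsLift m₁ m₂ η x) (i : ℕ) (k c : ℤ) :
    x i (k + c * m₁) = x i k + c * L :=
  add_mul_of_add_eq (h.add_label i) k c

lemma add_row_mul (h : IsLift m₁ m₂ η x) (i : ℕ) (k : ℤ) (c : ℕ) :
    x (i + N * c) k = x i (k + c * m₂) :=
  row_add_mul_of_add h.add_row i k c

lemma le_add (h : IsLift m₁ m₂ η x) (i j : ℕ) (k : ℤ) : x i k ≤ x (i + j) k := by
  induction j with
  | zero => simp
  | succ j ih => exact ih.trans (h.le_up _ _)

/-- Two integers over the same site column differ by a label shift. -/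
lemma exists_label_of_cast_eq (h : IsLift m₁ m₂ η x) {i : ℕ} {k y : ℤ}
    (e : ((x i k : ℤ) : ZMod L) = (y : ZMod L)) :
    ∃ c : ℤ, y = x i k + c * L ∧ y = x i (k + c * m₁) := by
  obtain ⟨c, hc⟩ := (ZMod.intCast_eq_intCast_iff_dvd_sub _ _ _).1 e
  refine ⟨c, by linarith, ?_⟩
  rw [h.add_label_mul]; linarith

section Gaps

lemma gapA_site (h : IsLift m₁ m₂ η x) (i : ℕ) (k : ℤ) :
    (gapA η (site L N x i k) : ℤ) = x i (k + 1) - x i k - 1 := by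
  have hlt := h.lt_succ i k
  obtain ⟨m, hm⟩ : ∃ m : ℕ, (m : ℤ) = x i (k + 1) - x i k - 1 := ⟨_, Int.toNat_of_nonneg (by omega)⟩
  rw [← hm, Nat.cast_inj]
  have key : ∀ n : ℕ, ((((x i k : ℤ) : ZMod L) + (n : ZMod L) + 1, (i : ZMod N)) : Site L N)
      = (((x i k + n + 1 : ℤ) : ZMod L), (i : ZMod N)) := by intro n; push_cast; rfl
  refine sInf_eq_of_forall_lt ?_ fun n hn => ?_
  · simp only [site, key]
    exact (h.mem _ _).2 ⟨k + 1, by omega⟩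
  · simp only [site, key]
    exact h.not_mem_of_lt_of_lt (k := k) (by omega) (by omega)

lemma gapD_site (h : IsLift m₁ m₂ η x) (i : ℕ) (k : ℤ) :
    (gapD η (site L N x i k) : ℤ) = x i k - x i (k - 1) - 1 := by
  have hlt := h.strictMono i (sub_one_lt k)
  obtain ⟨m, hm⟩ : ∃ m : ℕ, (m : ℤ) = x i k - x i (k - 1) - 1 := ⟨_, Int.toNat_of_nonneg (by omega)⟩
  rw [← hm, Nat.cast_inj]
  have key : ∀ n : ℕ, ((((x i k : ℤ) : ZMod L) - (n : ZMod L) - 1, (i : ZMod N)) : Site L N)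
      = (((x i k - n - 1 : ℤ) : ZMod L), (i : ZMod N)) := by intro n; push_cast; rfl
  refine sInf_eq_of_forall_lt ?_ fun n hn => ?_
  · simp only [site, key]
    exact (h.mem _ _).2 ⟨k - 1, by omega⟩
  · simp only [site, key]
    exact h.not_mem_of_lt_of_lt (k := k - 1) (by omega) (by rw [sub_add_cancel]; omega)

lemma gapF_site (h : IsLift m₁ m₂ η x) (i : ℕ) (k : ℤ) :
    (gapF η (site L N x i k) : ℤ) = x (i + 1) k - x i k := by
  have hle := h.le_up i k
  have hlt := h.up_lt i (k - 1)
  rw [sub_add_cancel] at hlt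
  obtain ⟨m, hm⟩ : ∃ m : ℕ, (m : ℤ) = x (i + 1) k - x i k := ⟨_, Int.toNat_of_nonneg (by omega)⟩
  rw [← hm, Nat.cast_inj]
  have key : ∀ n : ℕ, ((((x i k : ℤ) : ZMod L) + (n : ZMod L), (i : ZMod N) + 1) : Site L N)
      = (((x i k + n : ℤ) : ZMod L), ((i + 1 : ℕ) : ZMod N)) := by intro n; push_cast; rfl
  refine sInf_eq_of_forall_lt ?_ fun n hn => ?_
  · simp only [site, key]
    exact (h.mem _ _).2 ⟨k, by omega⟩
  · simp only [site, key]
    exact h.not_mem_of_lt_of_lt (k := k - 1) (by omega) (by rw [sub_add_cancel]; omega)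

lemma gapE_site (h : IsLift m₁ m₂ η x) (i : ℕ) (k : ℤ) :
    (gapE η (site L N x i k) : ℤ) = x i k - x (i + 1) (k - 1) - 1 := by
  have hle := h.le_up i k
  have hlt := h.up_lt i (k - 1)
  rw [sub_add_cancel] at hlt
  obtain ⟨m, hm⟩ : ∃ m : ℕ, (m : ℤ) = x i k - x (i + 1) (k - 1) - 1 :=
    ⟨_, Int.toNat_of_nonneg (by omega)⟩
  rw [← hm, Nat.cast_inj]
  have key : ∀ n : ℕ, ((((x i k : ℤ) : ZMod L) - (n : ZMod L) - 1, (i : ZMod N) + 1) : Site L N)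
      = (((x i k - n - 1 : ℤ) : ZMod L), ((i + 1 : ℕ) : ZMod N)) := by intro n; push_cast; rfl
  refine sInf_eq_of_forall_lt ?_ fun n hn => ?_
  · simp only [site, key]
    exact (h.mem _ _).2 ⟨k - 1, by omega⟩
  · simp only [site, key]
    exact h.not_mem_of_lt_of_lt (k := k - 1) (by omega) (by rw [sub_add_cancel]; omega)

lemma gapB_site (h : IsLift m₁ m₂ η x) (i : ℕ) (k : ℤ) :
    (gapB η (site L N x (i + 1) k) : ℤ) = x i (k + 1) - x (i + 1) k - 1 := by
  have hle := h.le_up i k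
  have hlt := h.up_lt i k
  obtain ⟨m, hm⟩ : ∃ m : ℕ, (m : ℤ) = x i (k + 1) - x (i + 1) k - 1 :=
    ⟨_, Int.toNat_of_nonneg (by omega)⟩
  rw [← hm, Nat.cast_inj]
  have key : ∀ n : ℕ, ((((x (i + 1) k : ℤ) : ZMod L) + (n : ZMod L) + 1,
      ((i + 1 : ℕ) : ZMod N) - 1) : Site L N)
      = (((x (i + 1) k + n + 1 : ℤ) : ZMod L), (i : ZMod N)) := by intro n; push_cast; simp
  refine sInf_eq_of_forall_lt ?_ fun n hn => ?_
  · simp only [site, key]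
    exact (h.mem _ _).2 ⟨k + 1, by omega⟩
  · simp only [site, key]
    exact h.not_mem_of_lt_of_lt (k := k) (by omega) (by omega)

lemma gapC_site (h : IsLift m₁ m₂ η x) (i : ℕ) (k : ℤ) :
    (gapC η (site L N x (i + 1) k) : ℤ) = x (i + 1) k - x i k := by
  have hle := h.le_up i k
  have hlt := h.up_lt i k
  obtain ⟨m, hm⟩ : ∃ m : ℕ, (m : ℤ) = x (i + 1) k - x i k := ⟨_, Int.toNat_of_nonneg (by omega)⟩
  rw [← hm, Nat.cast_inj]
  have key : ∀ n : ℕ, ((((x (i + 1) k : ℤ) : ZMod L) - (n : ZMod L),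
      ((i + 1 : ℕ) : ZMod N) - 1) : Site L N)
      = (((x (i + 1) k - n : ℤ) : ZMod L), (i : ZMod N)) := by intro n; push_cast; simp
  refine sInf_eq_of_forall_lt ?_ fun n hn => ?_
  · simp only [site, key]
    exact (h.mem _ _).2 ⟨k, by omega⟩
  · simp only [site, key]
    exact h.not_mem_of_lt_of_lt (k := k) (by omega) (by omega)

end Gaps

lemma upRight_site (h : IsLift m₁ m₂ η x) (i : ℕ) (k : ℤ) :
    upRight η (site L N x i k) = site L N x (i + 1) k := by
  have := congrArg (Int.cast : ℤ → ZMod L) (h.gapF_site (N := N) i k)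
  push_cast at this
  simp [upRight, this]
  simp [site]

lemma upRight_iterate_site (h : IsLift m₁ m₂ η x) (i : ℕ) (k : ℤ) (n : ℕ) :
    (upRight η)^[n] (site L N x i k) = site L N x (i + n) k := by
  induction n with
  | zero => rfl
  | succ n ih => rw [Function.iterate_succ_apply', ih, h.upRight_site]; rfl

lemma sum_gapF (h : IsLift m₁ m₂ η x) (i : ℕ) (k : ℤ) (n : ℕ) :
    ((∑ j ∈ Finset.range n, gapF η ((upRight η)^[j] (site L N x i k)) : ℕ) : ℤ) =
      x (i + n) k - x i k := by
  induction n with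
  | zero => simp
  | succ n ih =>
    rw [Finset.sum_range_succ, Nat.cast_add, ih, h.upRight_iterate_site, h.gapF_site]
    rw [add_assoc i n 1]; ring

lemma site_add_row (h : IsLift m₁ m₂ η x) (i : ℕ) (k : ℤ) (c : ℕ) :
    site L N x (i + N * c) k = site L N x i (k + c * m₂) := by
  simp [site, h.add_row_mul]

lemma site_add_label (h : IsLift m₁ m₂ η x) (i : ℕ) (k c : ℤ) :
    site L N x i (k + c * m₁) = site L N x i k := by
  simp [site, h.add_label_mul]

lemma winding [NeZero L] [NeZero N] (h : IsLift m₁ m₂ η x) (hm₁ : 0 < m₁) {p : Site L N}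
    (hp : p ∈ η) : 0 < windV η p ∧ windH η p * m₁ = windV η p * m₂ := by
  obtain ⟨i, k, rfl⟩ := h.exists_site_succ hp
  generalize i + 1 = i at *
  have hL : (0 : ℤ) < L := by exact_mod_cast Nat.pos_of_ne_zero (NeZero.ne L)
  have hN : 0 < N := Nat.pos_of_ne_zero (NeZero.ne N)
  set p := site L N x i k with hp'
  have hper : Function.IsPeriodicPt (upRight η) (N * m₁) p := by
    rw [Function.IsPeriodicPt, Function.IsFixedPt, hp', h.upRight_iterate_site, h.site_add_row,
      mul_comm, h.site_add_label]
  have hpos : 0 < loopLength η p := hper.minimalPeriod_pos (by positivity)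
  have hfix : (upRight η)^[loopLength η p] p = p := Function.iterate_minimalPeriod
  have hsum := h.sum_gapF i k (loopLength η p)
  rw [← hp'] at hsum
  rw [windV, windH]
  generalize loopLength η p = n at *
  rw [hp', h.upRight_iterate_site] at hfix
  obtain ⟨v, rfl⟩ : N ∣ n := by
    have := congrArg Prod.snd hfix
    simpa [site, ZMod.natCast_eq_zero_iff] using this
  rw [h.site_add_row] at hfix
  obtain ⟨c, hc₁, hc₂⟩ := h.exists_label_of_cast_eq (congrArg Prod.fst hfix).symm
  rw [h.add_row_mul, hc₁] at hsum
  have hvc : (v : ℤ) * m₂ = c * m₁ := by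
    have := (h.strictMono i).injective hc₂
    linarith
  have hc0 : 0 ≤ c := by
    have : 0 ≤ c * (m₁ : ℤ) := by rw [← hvc]; positivity
    exact nonneg_of_mul_nonneg_left this (by exact_mod_cast hm₁)
  lift c to ℕ using hc0
  have hs : (∑ j ∈ Finset.range (N * v), gapF η ((upRight η)^[j] p)) = c * L := by
    have : ((c : ℤ) * L) = ((c * L : ℕ) : ℤ) := by push_cast; rfl
    rw [add_sub_cancel_left, this] at hsum
    exact_mod_cast hsum
  rw [hs, Nat.mul_div_cancel_left _ hN, Nat.mul_div_cancel _ (by exact_mod_cast hL)]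
  exact ⟨Nat.pos_of_mul_pos_left hpos, by exact_mod_cast hvc.symm⟩

lemma interlacing [NeZero N] (h : IsLift m₁ m₂ η x) : Interlacing η := by
  intro p hp
  obtain ⟨i, k, rfl⟩ := h.exists_site_succ hp
  have hA := h.gapA_site (i + 1) k
  have hD := h.gapD_site (i + 1) k
  have h1 := h.le_up i (k + 1)
  have h2 := h.up_lt i k
  have h3 := h.le_up i k
  have h4 := h.up_lt i (k - 1)
  have h5 := h.up_lt i (k + 1)
  have h6 := h.le_up i (k - 1)
  rw [sub_add_cancel] at h4
  have keyp : ∀ n : ℕ, ((((x (i + 1) k : ℤ) : ZMod L) + (n : ZMod L),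
      ((i + 1 : ℕ) : ZMod N) - 1) : Site L N)
      = (((x (i + 1) k + n : ℤ) : ZMod L), (i : ZMod N)) := by intro n; push_cast; simp
  have keym : ∀ n : ℕ, ((((x (i + 1) k : ℤ) : ZMod L) - (n : ZMod L),
      ((i + 1 : ℕ) : ZMod N) - 1) : Site L N)
      = (((x (i + 1) k - n : ℤ) : ZMod L), (i : ZMod N)) := by intro n; push_cast; simp
  constructor
  · refine ⟨(x i (k + 1) - x (i + 1) k).toNat, ⟨by omega, ?_⟩, ?_⟩
    · simp only [site, keyp]
      exact (h.mem _ _).2 ⟨k + 1, by omega⟩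
    · rintro n ⟨hn, hmem⟩
      simp only [site, keyp] at hmem
      obtain ⟨j, hj⟩ := (h.mem _ _).1 hmem
      have : k < j := (h.strictMono i).lt_iff_lt.1 (by omega)
      have : j < k + 1 + 1 := (h.strictMono i).lt_iff_lt.1 (by omega)
      obtain rfl : j = k + 1 := by omega
      omega
  · refine ⟨(x (i + 1) k - x i k).toNat, ⟨by omega, ?_⟩, ?_⟩
    · simp only [site, keym]
      exact (h.mem _ _).2 ⟨k, by omega⟩
    · rintro n ⟨hn, hmem⟩
      simp only [site, keym] at hmem
      obtain ⟨j, hj⟩ := (h.mem _ _).1 hmem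
      have : k - 1 < j := (h.strictMono i).lt_iff_lt.1 (by omega)
      have : j < k + 1 := (h.strictMono i).lt_iff_lt.1 (by omega)
      obtain rfl : j = k := by omega
      omega

lemma card_row [NeZero N] (h : IsLift m₁ m₂ η x) (hm₁ : 0 < m₁) (r : ZMod N) :
    (η.filter (fun p => p.2 = r)).card = m₁ := by
  obtain ⟨i, rfl⟩ : ∃ i : ℕ, r = (i : ZMod N) := ⟨r.val, (ZMod.natCast_zmod_val r).symm⟩
  have hm : (0 : ℤ) < m₁ := by exact_mod_cast hm₁
  have : η.filter (fun p => p.2 = (i : ZMod N)) =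
      (Finset.range m₁).image (fun k : ℕ => site L N x i k) := by
    ext ⟨c, r⟩
    obtain ⟨y, rfl⟩ := ZMod.intCast_surjective c
    simp only [Finset.mem_filter, Finset.mem_image, Finset.mem_range]
    constructor
    · rintro ⟨hmem, rfl⟩
      obtain ⟨k, rfl⟩ := (h.mem _ _).1 hmem
      have h0 := Int.emod_nonneg k hm.ne'
      have h1 := Int.emod_lt_of_pos k hm
      refine ⟨(k % m₁).toNat, by omega, ?_⟩
      rw [Int.toNat_of_nonneg h0]
      have := h.site_add_label (L := L) (N := N) i (k % m₁) (k / m₁)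
      rw [mul_comm, Int.emod_add_mul_ediv] at this
      rw [← this]; rfl
    · rintro ⟨k, -, hk⟩
      exact ⟨hk ▸ h.site_mem _ _, (congrArg Prod.snd hk).symm⟩
  rw [this, Finset.card_image_of_injOn, Finset.card_range]
  intro k hk j hj e
  simp only [Finset.coe_range, Set.mem_Iio] at hk hj
  obtain ⟨c, -, hc⟩ := h.exists_label_of_cast_eq (congrArg Prod.fst e)
  have hc := (h.strictMono i).injective hc
  have : c = 0 := by
    rcases lt_trichotomy c 0 with h0 | h0 | h0
    · nlinarith
    · exact h0
    · nlinarith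
  subst this
  omega

/-- A set of sites with a lift lies in the sector. -/
lemma isConfig [NeZero L] [NeZero N] (h : IsLift m₁ m₂ η x) (hm₁ : 0 < m₁) :
    IsConfig m₁ m₂ η := by
  refine ⟨h.card_row hm₁, h.interlacing, fun p hp => ?_⟩
  obtain ⟨hv, e⟩ := h.winding hm₁ hp
  have hv' : (windV η p : ℚ) ≠ 0 := by exact_mod_cast hv.ne'
  have e' : (windH η p : ℚ) * m₁ = windV η p * m₂ := by exact_mod_cast e
  field_simp
  linarith

end IsLift

end Lift

end QWhittaker

namespace QWhittaker

variable {L N m₁ m₂ : ℕ}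

/-- A strictly monotone enumeration of one row of the lift of `η`. -/
structure IsRowLift (m₁ : ℕ) (η : Finset (Site L N)) (i : ℕ) (f : ℤ → ℤ) : Prop where
  strictMono : StrictMono f
  add_label : ∀ k, f (k + m₁) = f k + L
  mem : ∀ y : ℤ, ((y : ZMod L), (i : ZMod N)) ∈ η ↔ ∃ k, f k = y

lemma exists_isRowLift [NeZero L] {η : Finset (Site L N)} (hm₁ : 0 < m₁) (i : ℕ)
    (hcard : (η.filter (fun p => p.2 = (i : ZMod N))).card = m₁) :
    ∃ f, IsRowLift m₁ η i f := by
  have hL : (0 : ℤ) < L := by exact_mod_cast Nat.pos_of_ne_zero (NeZero.ne L)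
  have hm : (0 : ℤ) < m₁ := by exact_mod_cast hm₁
  set S : Finset ℕ := (η.filter (fun p => p.2 = (i : ZMod N))).image (fun p => p.1.val) with hS
  have hScard : S.card = m₁ := by
    rw [hS, Finset.card_image_of_injOn, hcard]
    rintro ⟨a, b⟩ hp ⟨c, d⟩ hq e
    simp only [Finset.coe_filter, Set.mem_ofPred_eq] at hp hq
    exact Prod.ext (ZMod.val_injective L e) (hp.2.trans hq.2.symm)
  have hmemS : ∀ n : ℕ, n ∈ S ↔ n < L ∧ ((n : ZMod L), (i : ZMod N)) ∈ η := by
    intro n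
    simp only [hS, Finset.mem_image, Finset.mem_filter]
    constructor
    · rintro ⟨⟨a, b⟩, ⟨h1, rfl⟩, rfl⟩
      exact ⟨ZMod.val_lt a, by simpa using h1⟩
    · rintro ⟨h1, h2⟩
      exact ⟨_, ⟨h2, rfl⟩, ZMod.val_cast_of_lt h1⟩
  let e := S.orderEmbOfFin hScard
  have hmod : ∀ k : ℤ, (k % m₁).toNat < m₁ := fun k => by
    have := Int.emod_nonneg k hm.ne'
    have := Int.emod_lt_of_pos k hm
    omega
  let f : ℤ → ℤ := fun k => (e ⟨(k % m₁).toNat, hmod k⟩ : ℕ) + L * (k / m₁)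
  have heL : ∀ j, e j < L := fun j => ((hmemS _).1 (S.orderEmbOfFin_mem hScard j)).1
  refine ⟨f, ?_, ?_, ?_⟩
  · refine strictMono_int_of_lt_succ fun k => ?_
    have h0 := Int.emod_nonneg k hm.ne'
    have h1 := Int.emod_lt_of_pos k hm
    have hdm := Int.emod_add_mul_ediv k m₁
    simp only [f]
    by_cases hk : k % m₁ + 1 < m₁
    · have hd : (k + 1) / m₁ = k / m₁ ∧ (k + 1) % m₁ = k % m₁ + 1 :=
        (Int.ediv_emod_unique hm).2 ⟨by linarith, by omega, hk⟩
      have : e ⟨(k % m₁).toNat, hmod k⟩ < e ⟨((k + 1) % m₁).toNat, hmod _⟩ := by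
        rw [e.lt_iff_lt, Fin.lt_def]
        simp only [hd.2]
        omega
      rw [hd.1]
      omega
    · have hd : (k + 1) / m₁ = k / m₁ + 1 ∧ (k + 1) % m₁ = 0 :=
        (Int.ediv_emod_unique hm).2 ⟨by linarith, le_rfl, hm⟩
      rw [hd.1]
      have := heL ⟨(k % m₁).toNat, hmod k⟩
      have h3 : (0 : ℤ) ≤ (e ⟨((k + 1) % m₁).toNat, hmod _⟩ : ℕ) := by positivity
      rw [mul_add]
      omega
  · intro k
    simp only [f, Int.add_emod_right]
    rw [Int.add_ediv_of_dvd_right (dvd_refl _), Int.ediv_self hm.ne']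
    ring
  · intro y
    constructor
    · intro hy
      have h0 := Int.emod_nonneg y hL.ne'
      have h1 := Int.emod_lt_of_pos y hL
      have hyS : (y % L).toNat ∈ S := by
        rw [hmemS]
        refine ⟨by omega, ?_⟩
        have : (((y % L).toNat : ℕ) : ZMod L) = (y : ZMod L) := by
          rw [← Int.cast_natCast, Int.toNat_of_nonneg h0]
          simp
        rwa [this]
      have : (y % L).toNat ∈ Set.range e := by
        rw [Finset.range_orderEmbOfFin]; exact hyS
      obtain ⟨j, hj⟩ := this
      refine ⟨j + m₁ * (y / L), ?_⟩
      have hj' : (j : ℤ) < m₁ := by exact_mod_cast j.2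
      have hd : ((j : ℤ) + m₁ * (y / L)) / m₁ = y / L ∧ ((j : ℤ) + m₁ * (y / L)) % m₁ = j :=
        (Int.ediv_emod_unique hm).2 ⟨by ring, by positivity, hj'⟩
      simp only [f, hd.1, hd.2]
      simp only [Int.toNat_natCast, Fin.eta, hj]
      rw [Int.toNat_of_nonneg h0]
      exact Int.emod_add_mul_ediv y L
    · rintro ⟨k, rfl⟩
      have := ((hmemS _).1 (S.orderEmbOfFin_mem hScard ⟨(k % m₁).toNat, hmod k⟩)).2
      simpa [f, e] using this

section Step

variable {η : Finset (Site L N)} {p : Site L N}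

lemma gapD_not_mem {n : ℕ} (hn : n < gapD η p) : (p.1 - (n : ZMod L) - 1, p.2) ∉ η :=
  fun h => Nat.notMem_of_lt_sInf hn h

lemma gapD_mem [NeZero L] (hp : p ∈ η) : (p.1 - (gapD η p : ZMod L) - 1, p.2) ∈ η := by
  refine Nat.sInf_mem (s := {n : ℕ | (p.1 - (n : ZMod L) - 1, p.2) ∈ η}) ⟨L - 1, ?_⟩
  have : 1 ≤ L := Nat.pos_of_ne_zero (NeZero.ne L)
  simpa [Nat.cast_sub this] using hp

lemma gapF_not_mem {n : ℕ} (hn : n < gapF η p) : (p.1 + (n : ZMod L), p.2 + 1) ∉ η :=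
  fun h => Nat.notMem_of_lt_sInf hn h

lemma gapF_mem [NeZero L] (hne : ∃ c : ZMod L, (c, p.2 + 1) ∈ η) : upRight η p ∈ η := by
  refine Nat.sInf_mem (s := {n : ℕ | (p.1 + (n : ZMod L), p.2 + 1) ∈ η}) ?_
  obtain ⟨c, hc⟩ := hne
  exact ⟨(c - p.1).val, by simpa using hc⟩

lemma isRowLift_succ [NeZero L] {i : ℕ} {f : ℤ → ℤ} (hη : Interlacing η)
    (hne : ∃ c : ZMod L, (c, ((i + 1 : ℕ) : ZMod N)) ∈ η) (hf : IsRowLift m₁ η i f) :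
    IsRowLift m₁ η (i + 1) (fun k => f k + gapF η ((f k : ZMod L), (i : ZMod N))) ∧
      ∀ k, f k + gapF η ((f k : ZMod L), (i : ZMod N)) < f (k + 1) := by
  set g : ℤ → ℤ := fun k => f k + gapF η ((f k : ZMod L), (i : ZMod N)) with hg
  have hg_mem : ∀ k, ((g k : ZMod L), ((i + 1 : ℕ) : ZMod N)) ∈ η := fun k => by
    have := gapF_mem (η := η) (p := ((f k : ZMod L), (i : ZMod N))) (by simpa using hne)
    simpa [upRight, hg] using this
  have hg_gap : ∀ k y, f k ≤ y → y < g k → ((y : ZMod L), ((i + 1 : ℕ) : ZMod N)) ∉ η := by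
    intro k y h1 h2
    have := gapF_not_mem (η := η) (p := ((f k : ZMod L), (i : ZMod N))) (n := (y - f k).toNat)
      (by simp only [hg] at h2; omega)
    rw [← Int.cast_natCast (R := ZMod L), Int.toNat_of_nonneg (by omega)] at this
    simpa using this
  have hD_gap : ∀ z y : ℤ, y < z → z - gapD η ((z : ZMod L), ((i + 1 : ℕ) : ZMod N)) - 1 < y →
      ((y : ZMod L), ((i + 1 : ℕ) : ZMod N)) ∉ η := by
    intro z y h1 h2
    have := gapD_not_mem (η := η) (p := ((z : ZMod L), ((i + 1 : ℕ) : ZMod N)))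
      (n := (z - y - 1).toNat) (by omega)
    rw [← Int.cast_natCast (R := ZMod L), Int.toNat_of_nonneg (by omega)] at this
    convert this using 2
    push_cast
    ring_nf
  have hD_mem : ∀ z : ℤ, ((z : ZMod L), ((i + 1 : ℕ) : ZMod N)) ∈ η →
      (((z - gapD η ((z : ZMod L), ((i + 1 : ℕ) : ZMod N)) - 1 : ℤ) : ZMod L),
        ((i + 1 : ℕ) : ZMod N)) ∈ η := by
    intro z hz
    simpa using gapD_mem hz
  have hlow : ∀ z : ℤ, ((z : ZMod L), ((i + 1 : ℕ) : ZMod N)) ∈ η → ∃! n : ℕ,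
      n ≤ gapD η ((z : ZMod L), ((i + 1 : ℕ) : ZMod N)) ∧
        (((z - n : ℤ) : ZMod L), (i : ZMod N)) ∈ η := by
    intro z hz
    simpa using (hη _ hz).2
  have hle : ∀ k, f k ≤ g k := fun k => by simp [hg]
  have hlt : ∀ k, g k < f (k + 1) := by
    intro k
    by_contra! hcon
    have hd := hD_mem _ (hg_mem k)
    have hfk : f k < f (k + 1) := hf.strictMono (lt_add_one k)
    obtain ⟨n, -, hn⟩ := hlow _ (hg_mem k)
    have hd' : g k - gapD η ((g k : ZMod L), ((i + 1 : ℕ) : ZMod N)) - 1 < f k := by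
      by_contra! hc
      exact hg_gap k _ hc (by omega) hd
    have h1 := hn (g k - f k).toNat ⟨by omega, by
      rw [Int.toNat_of_nonneg (by omega), sub_sub_cancel]; exact (hf.mem _).2 ⟨k, rfl⟩⟩
    have h2 := hn (g k - f (k + 1)).toNat ⟨by omega, by
      rw [Int.toNat_of_nonneg (by omega), sub_sub_cancel]; exact (hf.mem _).2 ⟨k + 1, rfl⟩⟩
    omega
  refine ⟨⟨strictMono_int_of_lt_succ fun k => (hlt k).trans_le (hle _), fun k => ?_,
    fun z => ⟨fun hz => ?_, ?_⟩⟩, hlt⟩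
  · simp only [hg, hf.add_label]
    push_cast
    simp only [CharP.cast_eq_zero, add_zero]
    ring
  · obtain ⟨n, ⟨hn, hmem⟩, -⟩ := hlow z hz
    obtain ⟨k, hk⟩ := (hf.mem _).1 hmem
    refine ⟨k, le_antisymm ?_ ?_⟩
    · by_contra! hc
      exact hg_gap k z (by omega) hc hz
    · by_contra! hc
      have := hle k
      exact hD_gap z (g k) hc (by omega) (hg_mem k)
  · rintro ⟨k, rfl⟩
    exact hg_mem k

end Step

lemma eq_add_of_strictMono_of_surjective {g : ℤ → ℤ} (hg : StrictMono g)
    (hs : Function.Surjective g) (k : ℤ) : g k = k + g 0 := by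
  have hsucc : ∀ k, g (k + 1) = g k + 1 := by
    intro k
    have h1 : g k < g (k + 1) := hg (lt_add_one k)
    obtain ⟨j, hj⟩ := hs (g k + 1)
    have h2 : k < j := hg.lt_iff_lt.1 (by omega)
    have h3 : g (k + 1) ≤ g j := hg.monotone (by omega)
    omega
  induction k using Int.induction_on with
  | zero => simp
  | succ k ih => rw [hsucc, ih]; ring
  | pred k ih =>
    have := hsucc (-(k : ℤ) - 1)
    rw [sub_add_cancel, ih] at this
    omega

/-- The labelling obtained by following up-right neighbours from the row `0`. -/
noncomputable def upLabel (η : Finset (Site L N)) (f : ℤ → ℤ) : ℕ → ℤ → ℤ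
  | 0, k => f k
  | i + 1, k => upLabel η f i k + gapF η ((upLabel η f i k : ZMod L), (i : ZMod N))

lemma exists_isLift_of_interlacing [NeZero L] [NeZero N] {η : Finset (Site L N)} (hm₁ : 0 < m₁)
    (hcard : ∀ i : ZMod N, (η.filter (fun p => p.2 = i)).card = m₁) (hη : Interlacing η) :
    ∃ s x, IsLift m₁ s η x := by
  obtain ⟨f, hf⟩ := exists_isRowLift hm₁ 0 (hcard (0 : ℕ))
  set x := upLabel η f with hx
  have hne : ∀ i : ℕ, ∃ c : ZMod L, (c, (i : ZMod N)) ∈ η := by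
    intro i
    have : 0 < (η.filter (fun p => p.2 = (i : ZMod N))).card := by rw [hcard]; exact hm₁
    obtain ⟨⟨c, r⟩, hp⟩ := Finset.card_pos.1 this
    rw [Finset.mem_filter] at hp
    exact ⟨c, hp.2 ▸ hp.1⟩
  have hrow : ∀ i, IsRowLift m₁ η i (x i) := by
    intro i
    induction i with
    | zero => exact hf
    | succ i ih => exact (isRowLift_succ hη (hne (i + 1)) ih).1
  have hlt : ∀ i k, x (i + 1) k < x i (k + 1) := fun i =>
    (isRowLift_succ hη (hne (i + 1)) (hrow i)).2
  have hle : ∀ i k, x i k ≤ x (i + 1) k := fun i k => by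
    simp [hx, upLabel]
  have hNmem : ∀ y, (∃ k, x N k = y) ↔ ∃ k, x 0 k = y := fun y => by
    rw [← (hrow N).mem, ← (hrow 0).mem]; simp
  choose g hg using fun k => (hNmem (x N k)).1 ⟨k, rfl⟩
  have hgm : StrictMono g := fun a b hab => by
    rw [← (hrow 0).strictMono.lt_iff_lt, hg, hg]
    exact (hrow N).strictMono hab
  have hgs : Function.Surjective g := fun k => by
    obtain ⟨j, hj⟩ := (hNmem (x 0 k)).2 ⟨k, rfl⟩
    exact ⟨j, (hrow 0).strictMono.injective (by rw [hg, hj])⟩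
  have hs : 0 ≤ g 0 := by
    rw [← (hrow 0).strictMono.le_iff_le, hg]
    exact monotone_nat_of_le_succ (f := fun i => x i 0) (fun i => hle i 0) (Nat.zero_le N)
  obtain ⟨s, hs⟩ := Int.eq_ofNat_of_zero_le hs
  refine ⟨s, x, hle, hlt, fun i => (hrow i).add_label, fun i => ?_, fun i => (hrow i).mem⟩
  induction i with
  | zero =>
    intro k
    rw [zero_add, ← hs, ← eq_add_of_strictMono_of_surjective hgm hgs, hg]
  | succ i ih =>
    intro k
    rw [add_right_comm]
    simp only [hx, upLabel] at ih ⊢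
    rw [ih]
    simp

lemma IsConfig.exists_isLift [NeZero L] [NeZero N] {η : Finset (Site L N)} (hm₁ : 0 < m₁)
    (hη : IsConfig m₁ m₂ η) : ∃ x, IsLift m₁ m₂ η x := by
  obtain ⟨s, x, h⟩ := exists_isLift_of_interlacing hm₁ hη.1 hη.2.1
  have hp := h.site_mem 0 0
  obtain ⟨hv, e⟩ := h.winding hm₁ hp
  have hw := hη.2.2 _ hp
  have hv' : (windV η (site L N x 0 0) : ℚ) ≠ 0 := by exact_mod_cast hv.ne'
  have e' : (windH η (site L N x 0 0) : ℚ) * m₁ = windV η (site L N x 0 0) * s := by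
    exact_mod_cast e
  have : (m₂ : ℚ) = s := by
    rw [hw, mul_div_assoc', mul_comm (m₁ : ℚ), e', mul_div_cancel_left₀ _ hv']
  obtain rfl : m₂ = s := by exact_mod_cast this
  exact ⟨x, h⟩

/-- Any labelling with the right periodicity and interlacing is the lift of a configuration. -/
lemma exists_isLift_of_labelling [NeZero L] [NeZero N] {x : ℕ → ℤ → ℤ}
    (le_up : ∀ i k, x i k ≤ x (i + 1) k) (up_lt : ∀ i k, x (i + 1) k < x i (k + 1))
    (add_label : ∀ i k, x i (k + m₁) = x i k + L) (add_row : ∀ i k, x (i + N) k = x i (k + m₂)) :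
    ∃ η : Finset (Site L N), IsLift m₁ m₂ η x := by
  classical
  set η : Finset (Site L N) := Finset.univ.filter (fun p => ∃ i k, p = site L N x i k) with hη
  refine ⟨η, le_up, up_lt, add_label, add_row, fun i y => ⟨fun h => ?_, ?_⟩⟩
  · simp only [hη, Finset.mem_filter, Finset.mem_univ, true_and] at h
    obtain ⟨j, k, e⟩ := h
    have hr : (i : ZMod N) = (j : ZMod N) := congrArg Prod.snd e
    have hc : (y : ZMod L) = (x j k : ℤ) := congrArg Prod.fst e
    obtain ⟨k', hk'⟩ : ∃ k', x i k' = x j k := by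
      have hmod : i % N = j % N := (ZMod.natCast_eq_natCast_iff' i j N).1 hr
      have h1 : ∀ k, x i k = x (i % N) (k + (i / N : ℕ) * m₂) := fun k => by
        rw [← row_add_mul_of_add add_row, Nat.mod_add_div]
      have h2 : ∀ k, x j k = x (j % N) (k + (j / N : ℕ) * m₂) := fun k => by
        rw [← row_add_mul_of_add add_row, Nat.mod_add_div]
      refine ⟨k + (j / N : ℕ) * m₂ - (i / N : ℕ) * m₂, ?_⟩
      rw [h1, h2, hmod, sub_add_cancel]
    obtain ⟨c, hc⟩ := (ZMod.intCast_eq_intCast_iff_dvd_sub _ _ _).1 hc.symm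
    refine ⟨k' + c * m₁, ?_⟩
    rw [add_mul_of_add_eq (add_label i), hk']
    linarith
  · rintro ⟨k, rfl⟩
    simp only [hη, Finset.mem_filter, Finset.mem_univ, true_and]
    exact ⟨i, k, rfl⟩

theorem nonempty_config [NeZero L] [NeZero N] (hm₁ : 0 < m₁)
    (hm : (m₁ : ℝ) / L + (m₂ : ℝ) / N < 1) : Nonempty (Config L N m₁ m₂) := by
  have hL : (0 : ℝ) < L := by exact_mod_cast Nat.pos_of_ne_zero (NeZero.ne L)
  have hN : (0 : ℝ) < N := by exact_mod_cast Nat.pos_of_ne_zero (NeZero.ne N)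
  have hm₁' : (0 : ℝ) < m₁ := by exact_mod_cast hm₁
  suffices h : ∃ η : Finset (Site L N), IsLift m₁ m₂ η
      (fun i k => ⌊(L : ℝ) / m₁ * (k + m₂ / N * i)⌋) by
    obtain ⟨η, h⟩ := h
    exact ⟨⟨η, h.isConfig hm₁⟩⟩
  refine exists_isLift_of_labelling (fun i k => ?_) (fun i k => ?_) (fun i k => ?_) fun i k => ?_
  · refine Int.floor_le_floor ?_
    push_cast
    gcongr
    exact le_add_of_nonneg_right zero_le_one
  · rw [← Int.add_one_le_iff, ← Int.floor_add_one]
    refine Int.floor_le_floor ?_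
    push_cast
    have : (1 : ℝ) ≤ L / m₁ * (1 - m₂ / N) := by
      rw [div_mul_eq_mul_div, le_div_iff₀ hm₁', one_mul]
      have : (m₁ : ℝ) / L ≤ 1 - m₂ / N := by linarith
      rwa [div_le_iff₀' hL] at this
    linarith
  · rw [← Int.floor_add_natCast]
    congr 1
    push_cast
    field_simp
    ring
  · congr 1
    push_cast
    field_simp
    ring

end QWhittaker

namespace QWhittaker

variable {L N m₁ m₂ : ℕ} {η : Finset (Site L N)} {x : ℕ → ℤ → ℤ} {i₀ H : ℕ} {k₀ : ℤ}

section Neighbours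

/-- The next particle to the right on the same row. -/
noncomputable def rightN (η : Finset (Site L N)) (p : Site L N) : Site L N :=
  (p.1 + (gapA η p : ZMod L) + 1, p.2)

/-- The next particle strictly to the right on the row below. -/
noncomputable def lowRight (η : Finset (Site L N)) (p : Site L N) : Site L N :=
  (p.1 + (gapB η p : ZMod L) + 1, p.2 - 1)

/-- The next particle weakly to the left on the row below. -/
noncomputable def lowLeft (η : Finset (Site L N)) (p : Site L N) : Site L N :=
  (p.1 - (gapC η p : ZMod L), p.2 - 1)

namespace IsLift

lemma rightN_site (h : IsLift m₁ m₂ η x) (i : ℕ) (k : ℤ) :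
    rightN η (site L N x i k) = site L N x i (k + 1) := by
  have := congrArg (Int.cast : ℤ → ZMod L) (h.gapA_site (N := N) i k)
  push_cast at this
  simp only [rightN, this]
  simp [site]
  ring

lemma lowRight_site (h : IsLift m₁ m₂ η x) (i : ℕ) (k : ℤ) :
    lowRight η (site L N x (i + 1) k) = site L N x i (k + 1) := by
  have := congrArg (Int.cast : ℤ → ZMod L) (h.gapB_site (N := N) i k)
  push_cast at this
  simp only [lowRight, this]
  simp [site]
  ring

lemma lowLeft_site (h : IsLift m₁ m₂ η x) (i : ℕ) (k : ℤ) :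
    lowLeft η (site L N x (i + 1) k) = site L N x i k := by
  have := congrArg (Int.cast : ℤ → ZMod L) (h.gapC_site (N := N) i k)
  push_cast at this
  simp only [lowLeft, this]
  simp [site]

end IsLift

end Neighbours

/-- The labels `(i₀ + 1 + j, k₀)`, `j < H`, form a maximal vertical stack whose lowest particle can
jump to the right. -/
structure IsStack (N : ℕ) (x : ℕ → ℤ → ℤ) (i₀ H : ℕ) (k₀ : ℤ) : Prop where
  pos : 0 < H
  lt_rows : H < N
  eq : ∀ j < H, x (i₀ + 1 + j) k₀ = x (i₀ + 1) k₀
  lt_top : x (i₀ + 1) k₀ < x (i₀ + 1 + H) k₀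
  free : x (i₀ + 1) k₀ + 1 < x i₀ (k₀ + 1)

/-- The particles of a stack. -/
def stack (L N : ℕ) (x : ℕ → ℤ → ℤ) (i₀ H : ℕ) (k₀ : ℤ) : Finset (Site L N) :=
  (Finset.range H).image fun j => site L N x (i₀ + 1 + j) k₀

/-- The labelling after a stack has moved one site to the right. -/
noncomputable def move (L N : ℕ) (x : ℕ → ℤ → ℤ) (i₀ H : ℕ) (k₀ : ℤ) : ℕ → ℤ → ℤ :=
  fun i k => x i k + if site L N x i k ∈ stack L N x i₀ H k₀ then 1 else 0

lemma move_of_mem {i : ℕ} {k : ℤ} (hk : site L N x i k ∈ stack L N x i₀ H k₀) :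
    move L N x i₀ H k₀ i k = x i k + 1 := by
  simp only [move, if_pos hk]

lemma move_of_not_mem {i : ℕ} {k : ℤ} (hk : site L N x i k ∉ stack L N x i₀ H k₀) :
    move L N x i₀ H k₀ i k = x i k := by
  simp only [move, if_neg hk, add_zero]

lemma mem_stack {p : Site L N} :
    p ∈ stack L N x i₀ H k₀ ↔ ∃ j < H, p = site L N x (i₀ + 1 + j) k₀ := by
  simp only [stack, Finset.mem_image, Finset.mem_range]
  exact exists_congr fun j => and_congr_right fun _ => eq_comm

namespace IsLift

lemma exists_isStack [NeZero L] [NeZero N] (h : IsLift m₁ m₂ η x) (hm₂ : 1 ≤ m₂)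
    (hB : 0 < gapB η (site L N x (i₀ + 1) k₀)) : ∃ H, IsStack N x i₀ H k₀ := by
  have hN : 0 < N := Nat.pos_of_ne_zero (NeZero.ne N)
  have hfree : x (i₀ + 1) k₀ + 1 < x i₀ (k₀ + 1) := by
    have := h.gapB_site i₀ k₀
    omega
  have hex : ∃ j, x (i₀ + 1) k₀ < x (i₀ + 1 + j) k₀ := by
    refine ⟨N, ?_⟩
    rw [h.add_row]
    exact h.strictMono _ (by omega)
  have hmin : ∀ j < Nat.find hex, x (i₀ + 1 + j) k₀ = x (i₀ + 1) k₀ := fun j hj =>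
    le_antisymm (not_lt.1 (Nat.find_min hex hj)) (h.le_add _ _ _)
  refine ⟨Nat.find hex, ?_, ?_, hmin, Nat.find_spec hex, hfree⟩
  · rw [Nat.find_pos]; simp
  · by_contra! hc
    have h1 := hmin (N - 1) (by omega)
    rw [show i₀ + 1 + (N - 1) = i₀ + N by omega, h.add_row] at h1
    have h2 : x i₀ (k₀ + 1) ≤ x i₀ (k₀ + m₂) := (h.strictMono i₀).monotone (by omega)
    omega

lemma stack_subset (h : IsLift m₁ m₂ η x) : stack L N x i₀ H k₀ ⊆ η := by
  intro p hp
  obtain ⟨j, -, rfl⟩ := mem_stack.1 hp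
  exact h.site_mem _ _

lemma family_eq_stack (h : IsLift m₁ m₂ η x) (hs : IsStack N x i₀ H k₀) :
    family η (site L N x (i₀ + 1) k₀) = stack L N x i₀ H k₀ := by
  ext p
  simp only [family, Finset.mem_filter]
  constructor
  · rintro ⟨-, hr⟩
    induction hr with
    | refl => exact mem_stack.2 ⟨0, hs.pos, rfl⟩
    | tail _ he ih =>
      obtain ⟨j, hj, rfl⟩ := mem_stack.1 ih
      obtain ⟨-, hF, rfl⟩ := he
      have := h.gapF_site (i₀ + 1 + j) k₀
      have h1 := hs.eq j hj
      have h2 := hs.lt_top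
      rw [h.upRight_site]
      refine mem_stack.2 ⟨j + 1, ?_, rfl⟩
      rcases (Nat.succ_le_of_lt hj).eq_or_lt with rfl | hlt
      · rw [← add_assoc (i₀ + 1) j 1] at h2
        omega
      · exact hlt
  · intro hp
    refine ⟨h.stack_subset hp, ?_⟩
    obtain ⟨j, hj, rfl⟩ := mem_stack.1 hp
    clear hp
    induction j with
    | zero => exact Relation.ReflTransGen.refl
    | succ j ih =>
      refine (ih (by omega)).tail ⟨h.site_mem _ _, ?_, (h.upRight_site _ _).symm⟩
      have := h.gapF_site (i₀ + 1 + j) k₀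
      have h1 := hs.eq j (by omega)
      have h2 := hs.eq (j + 1) hj
      rw [← add_assoc (i₀ + 1) j 1] at h2
      omega

section Stack

variable {i : ℕ} {k : ℤ}

lemma fst_of_mem_stack (hs : IsStack N x i₀ H k₀) {p : Site L N}
    (hp : p ∈ stack L N x i₀ H k₀) : p.1 = (x (i₀ + 1) k₀ : ℤ) := by
  obtain ⟨j, hj, rfl⟩ := mem_stack.1 hp
  simp [site, hs.eq j hj]

lemma up_mem_stack (h : IsLift m₁ m₂ η x) (hs : IsStack N x i₀ H k₀)
    (hk : site L N x i k ∈ stack L N x i₀ H k₀) (e : x (i + 1) k = x i k) :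
    site L N x (i + 1) k ∈ stack L N x i₀ H k₀ := by
  obtain ⟨j, hj, hk⟩ := mem_stack.1 hk
  have h1 := h.gapF_site (L := L) (N := N) i k
  have h2 := h.gapF_site (L := L) (N := N) (i₀ + 1 + j) k₀
  have h3 := hs.eq j hj
  have h4 := hs.lt_top
  rw [hk] at h1
  refine mem_stack.2 ⟨j + 1, ?_, ?_⟩
  · rcases (Nat.succ_le_of_lt hj).eq_or_lt with rfl | hlt
    · rw [← add_assoc (i₀ + 1) j 1] at h4
      omega
    · exact hlt
  · rw [← h.upRight_site, hk, h.upRight_site]; rfl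

lemma free_of_mem_stack (h : IsLift m₁ m₂ η x) (hs : IsStack N x i₀ H k₀)
    (hk : site L N x (i + 1) k ∈ stack L N x i₀ H k₀) : x (i + 1) k + 1 < x i (k + 1) := by
  obtain ⟨j, hj, hk⟩ := mem_stack.1 hk
  have h1 := h.gapB_site (L := L) (N := N) i k
  have h2 := h.gapB_site (L := L) (N := N) (i₀ + j) k₀
  have h3 := hs.eq j hj
  have h4 := hs.free
  have h5 := h.le_add i₀ j (k₀ + 1)
  rw [add_right_comm] at hk h3
  rw [hk] at h1
  omega

lemma right_not_mem_stack (h : IsLift m₁ m₂ η x) (hm₁ : 1 < m₁) (hs : IsStack N x i₀ H k₀)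
    (hk : site L N x i k ∈ stack L N x i₀ H k₀) :
    site L N x i (k + 1) ∉ stack L N x i₀ H k₀ := by
  intro hk'
  obtain ⟨c, -, hc⟩ := h.exists_label_of_cast_eq
    ((fst_of_mem_stack hs hk).trans (fst_of_mem_stack hs hk').symm)
  have hc := (h.strictMono i).injective hc
  have h1 : c * (m₁ : ℤ) = 1 := by linarith
  have := Int.eq_one_or_neg_one_of_mul_eq_one' h1
  omega

lemma lowRight_not_mem_stack (h : IsLift m₁ m₂ η x) (hm₁ : 1 < m₁) (hs : IsStack N x i₀ H k₀)
    (hk : site L N x (i + 1) k ∈ stack L N x i₀ H k₀) :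
    site L N x i (k + 1) ∉ stack L N x i₀ H k₀ := by
  intro hk'
  obtain ⟨c, -, hc⟩ := h.exists_label_of_cast_eq
    ((fst_of_mem_stack hs hk).trans (fst_of_mem_stack hs hk').symm)
  have h1 := h.free_of_mem_stack hs hk
  have h2 := h.le_up i (k + 1)
  have h3 : k < k + c * m₁ := (h.strictMono (i + 1)).lt_iff_lt.1 (by omega)
  have h4 : k + c * m₁ ≤ k + 1 := (h.strictMono (i + 1)).le_iff_le.1 (by omega)
  have h5 : c * (m₁ : ℤ) = 1 := by omega
  have := Int.eq_one_or_neg_one_of_mul_eq_one' h5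
  omega

lemma eq_of_mem_stack (h : IsLift m₁ m₂ η x) (hs : IsStack N x i₀ H k₀)
    (hk : site L N x (i + 1) k ∈ stack L N x i₀ H k₀)
    (hk' : site L N x i k ∈ stack L N x i₀ H k₀) : x (i + 1) k = x i k := by
  obtain ⟨c, -, hc⟩ := h.exists_label_of_cast_eq
    ((fst_of_mem_stack hs hk').trans (fst_of_mem_stack hs hk).symm)
  have h1 := h.free_of_mem_stack hs hk
  have h2 := h.le_up i k
  have h3 : k ≤ k + c * m₁ := (h.strictMono i).le_iff_le.1 (by omega)
  have h4 : k + c * m₁ < k + 1 := (h.strictMono i).lt_iff_lt.1 (by omega)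
  rw [hc]
  congr 1
  omega

lemma low_not_mem_stack (hs : IsStack N x i₀ H k₀) :
    site L N x i₀ k₀ ∉ stack L N x i₀ H k₀ := by
  intro hk
  obtain ⟨j, hj, hk⟩ := mem_stack.1 hk
  have : ((j + 1 : ℕ) : ZMod N) = 0 := by
    have := congrArg Prod.snd hk
    simp only [site, Nat.cast_add, add_assoc] at this
    push_cast
    rw [add_comm]
    simpa using this.symm
  rw [ZMod.natCast_eq_zero_iff] at this
  have := Nat.le_of_dvd (by omega) this
  have := hs.lt_rows
  omega

lemma bottom_iff (h : IsLift m₁ m₂ η x) (hs : IsStack N x i₀ H k₀) :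
    (site L N x (i + 1) k ∈ stack L N x i₀ H k₀ ∧ site L N x i k ∉ stack L N x i₀ H k₀) ↔
      site L N x (i + 1) k = site L N x (i₀ + 1) k₀ := by
  constructor
  · rintro ⟨h1, h2⟩
    obtain ⟨j, hj, h1⟩ := mem_stack.1 h1
    obtain _ | j := j
    · exact h1
    · refine absurd (mem_stack.2 ⟨j, by omega, ?_⟩) h2
      rw [← h.lowLeft_site, h1, ← add_assoc, h.lowLeft_site]
  · intro e
    refine ⟨e ▸ mem_stack.2 ⟨0, hs.pos, rfl⟩, ?_⟩
    rw [← h.lowLeft_site, e, h.lowLeft_site]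
    exact low_not_mem_stack hs

lemma above_iff (h : IsLift m₁ m₂ η x) (hs : IsStack N x i₀ H k₀) :
    (site L N x (i + 1) k ∉ stack L N x i₀ H k₀ ∧ site L N x i k ∈ stack L N x i₀ H k₀) ↔
      site L N x (i + 1) k = site L N x (i₀ + 1 + H) k₀ := by
  constructor
  · rintro ⟨h1, h2⟩
    obtain ⟨j, hj, h2⟩ := mem_stack.1 h2
    have e : site L N x (i + 1) k = site L N x (i₀ + 1 + (j + 1)) k₀ := by
      rw [← h.upRight_site, h2, h.upRight_site]; rfl
    rcases (Nat.succ_le_of_lt hj).eq_or_lt with rfl | hlt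
    · exact e
    · exact absurd (mem_stack.2 ⟨j + 1, hlt, e⟩) h1
  · intro e
    obtain ⟨H', rfl⟩ : ∃ H', H = H' + 1 := ⟨H - 1, by have := hs.pos; omega⟩
    have e' : site L N x i k = site L N x (i₀ + 1 + H') k₀ := by
      rw [← h.lowLeft_site, e, ← add_assoc, h.lowLeft_site]
    have h2 : site L N x i k ∈ stack L N x i₀ (H' + 1) k₀ := mem_stack.2 ⟨H', by omega, e'⟩
    refine ⟨fun h1 => ?_, h2⟩
    have h3 := h.eq_of_mem_stack hs h1 h2
    have h4 := h.gapF_site (L := L) (N := N) i k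
    have h5 := h.gapF_site (L := L) (N := N) (i₀ + 1 + H') k₀
    rw [e'] at h4
    have h6 := hs.lt_top
    have h7 := hs.eq H' (by omega)
    rw [← add_assoc] at h6
    omega

end Stack

lemma isLift_move (h : IsLift m₁ m₂ η x) (hs : IsStack N x i₀ H k₀) :
    IsLift m₁ m₂ (shift η (site L N x (i₀ + 1) k₀)) (move L N x i₀ H k₀) := by
  refine ⟨fun i k => ?_, fun i k => ?_, fun i k => ?_, fun i k => ?_, fun i y => ?_⟩
  · have h1 := h.le_up i k
    have h2 := h.up_mem_stack hs (i := i) (k := k)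
    simp only [move]
    split_ifs with h3 h4 h4
    · omega
    · have : x (i + 1) k ≠ x i k := fun e => h4 (h2 h3 e)
      omega
    · omega
    · omega
  · have h1 := h.up_lt i k
    have h2 := h.free_of_mem_stack hs (i := i) (k := k)
    simp only [move]
    split_ifs with h3 h4 h4
    · have := h2 h3; omega
    · have := h2 h3; omega
    · omega
    · omega
  · have h1 := h.site_add_label (L := L) (N := N) i k 1
    rw [one_mul] at h1
    simp only [move, h1, h.add_label]
    ring
  · have h1 := h.site_add_row (L := L) (N := N) i k 1
    rw [mul_one, Nat.cast_one, one_mul] at h1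
    simp only [move, h1, h.add_row]
  · simp only [shift, h.family_eq_stack hs, Finset.mem_union, Finset.mem_sdiff, Finset.mem_image]
    constructor
    · rintro (⟨h1, h2⟩ | ⟨s, h1, h2⟩)
      · obtain ⟨k, rfl⟩ := (h.mem _ _).1 h1
        exact ⟨k, move_of_not_mem h2⟩
      · obtain ⟨j, hj, rfl⟩ := mem_stack.1 h1
        have e : site L N x (i₀ + 1 + j) k₀ = (((y - 1 : ℤ) : ZMod L), (i : ZMod N)) := by
          rw [Prod.ext_iff] at h2 ⊢
          refine ⟨?_, h2.2⟩
          push_cast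
          exact eq_sub_of_add_eq h2.1
        rw [e] at h1
        obtain ⟨k, hk⟩ := (h.mem i (y - 1)).1 (h.stack_subset h1)
        refine ⟨k, ?_⟩
        have : site L N x i k ∈ stack L N x i₀ H k₀ := by rw [site, hk]; exact h1
        rw [move_of_mem this, hk, sub_add_cancel]
    · rintro ⟨k, rfl⟩
      by_cases hk : site L N x i k ∈ stack L N x i₀ H k₀
      · refine Or.inr ⟨_, hk, ?_⟩
        rw [move_of_mem hk]
        simp [site]
      · left
        rw [move_of_not_mem hk]
        exact ⟨h.site_mem _ _, hk⟩

end IsLift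

end QWhittaker

namespace QWhittaker

variable {L N m₁ m₂ : ℕ} {η : Finset (Site L N)} {x : ℕ → ℤ → ℤ} {i₀ H : ℕ} {k₀ : ℤ}
  {q : ℝ} {a : ZMod N → ℝ}

section QPoch

lemma one_sub_pow_pos (hq0 : 0 ≤ q) (hq1 : q < 1) {n : ℕ} (hn : 0 < n) : 0 < 1 - q ^ n :=
  sub_pos.2 (pow_lt_one₀ hq0 hq1 hn.ne')

lemma one_sub_pow_nonneg (hq0 : 0 ≤ q) (hq1 : q < 1) (n : ℕ) : 0 ≤ 1 - q ^ n :=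
  sub_nonneg.2 (pow_le_one₀ hq0 hq1.le)

lemma qPoch_pos (hq0 : 0 ≤ q) (hq1 : q < 1) (n : ℕ) : 0 < qPoch q n :=
  Finset.prod_pos fun _ _ => one_sub_pow_pos hq0 hq1 (Nat.succ_pos _)

lemma qPoch_succ (n : ℕ) : qPoch q (n + 1) = qPoch q n * (1 - q ^ (n + 1)) :=
  Finset.prod_range_succ _ _

end QPoch

section Reindex

@[to_additive]
lemma _root_.Finset.prod_comp_of_surjOn {α M : Type*} [DecidableEq α] [CommMonoid M] {s : Finset α}
    {T : α → α} (hT : ∀ p ∈ s, T p ∈ s) (hs : ∀ p ∈ s, ∃ p' ∈ s, T p' = p) (f : α → M) :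
    ∏ p ∈ s, f (T p) = ∏ p ∈ s, f p := by
  have him : s.image T = s := by
    ext p
    rw [Finset.mem_image]
    exact ⟨fun ⟨p', h, e⟩ => e ▸ hT _ h, hs p⟩
  have hinj : Set.InjOn T s := Finset.card_image_iff.1 (by rw [him])
  rw [← Finset.prod_image (f := f) hinj, him]

namespace IsLift

@[to_additive]
lemma prod_rightN [NeZero N] {M : Type*} [CommMonoid M] (h : IsLift m₁ m₂ η x)
    (f : Site L N → M) : ∏ p ∈ η, f (rightN η p) = ∏ p ∈ η, f p := by
  refine Finset.prod_comp_of_surjOn (fun p hp => ?_) (fun p hp => ?_) f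
  · obtain ⟨i, k, rfl⟩ := h.exists_site_succ hp
    rw [h.rightN_site]; exact h.site_mem _ _
  · obtain ⟨i, k, rfl⟩ := h.exists_site_succ hp
    exact ⟨site L N x (i + 1) (k - 1), h.site_mem _ _, by rw [h.rightN_site, sub_add_cancel]⟩

@[to_additive]
lemma prod_lowRight [NeZero N] {M : Type*} [CommMonoid M] (h : IsLift m₁ m₂ η x)
    (f : Site L N → M) : ∏ p ∈ η, f (lowRight η p) = ∏ p ∈ η, f p := by
  refine Finset.prod_comp_of_surjOn (fun p hp => ?_) (fun p hp => ?_) f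
  · obtain ⟨i, k, rfl⟩ := h.exists_site_succ hp
    rw [h.lowRight_site]; exact h.site_mem _ _
  · obtain ⟨i, k, rfl⟩ := h.exists_site_succ hp
    exact ⟨site L N x (i + 1 + 1) (k - 1), h.site_mem _ _, by rw [h.lowRight_site, sub_add_cancel]⟩

@[to_additive]
lemma prod_lowLeft [NeZero N] {M : Type*} [CommMonoid M] (h : IsLift m₁ m₂ η x)
    (f : Site L N → M) : ∏ p ∈ η, f (lowLeft η p) = ∏ p ∈ η, f p := by
  refine Finset.prod_comp_of_surjOn (fun p hp => ?_) (fun p hp => ?_) f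
  · obtain ⟨i, k, rfl⟩ := h.exists_site_succ hp
    rw [h.lowLeft_site]; exact h.site_mem _ _
  · obtain ⟨i, k, rfl⟩ := h.exists_site_succ hp
    exact ⟨site L N x (i + 1 + 1) k, h.site_mem _ _, h.lowLeft_site _ _⟩

end IsLift

/-- Moves the sites of `V` one step to the right and fixes the others. -/
def jump (V : Finset (Site L N)) (p : Site L N) : Site L N :=
  if p ∈ V then (p.1 + 1, p.2) else p

lemma jump_site (i : ℕ) (k : ℤ) :
    jump (stack L N x i₀ H k₀) (site L N x i k) = site L N (move L N x i₀ H k₀) i k := by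
  by_cases hk : site L N x i k ∈ stack L N x i₀ H k₀
  · rw [jump, if_pos hk, site, site, move_of_mem hk]
    push_cast; rfl
  · rw [jump, if_neg hk, site, site, move_of_not_mem hk]

lemma IsLift.shift_eq_image (h : IsLift m₁ m₂ η x) (hs : IsStack N x i₀ H k₀) :
    shift η (site L N x (i₀ + 1) k₀) = η.image (jump (stack L N x i₀ H k₀)) := by
  ext p
  simp only [shift, h.family_eq_stack hs, Finset.mem_union, Finset.mem_sdiff, Finset.mem_image]
  constructor
  · rintro (⟨h1, h2⟩ | ⟨s, h1, rfl⟩)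
    · exact ⟨p, h1, if_neg h2⟩
    · exact ⟨s, h.stack_subset h1, if_pos h1⟩
  · rintro ⟨s, h1, rfl⟩
    by_cases hV : s ∈ stack L N x i₀ H k₀
    · exact Or.inr ⟨s, hV, by rw [jump, if_pos hV]⟩
    · exact Or.inl (by rw [jump, if_neg hV]; exact ⟨h1, hV⟩)

lemma IsLift.right_site_empty [NeZero N] (h : IsLift m₁ m₂ η x) (hs : IsStack N x i₀ H k₀)
    {p : Site L N} (hp : p ∈ stack L N x i₀ H k₀) : (p.1 + 1, p.2) ∉ η := by
  obtain ⟨i, k, rfl⟩ := h.exists_site_succ (h.stack_subset hp)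
  have h1 := h.free_of_mem_stack hs hp
  have h2 := h.le_up i (k + 1)
  have := h.not_mem_of_lt_of_lt (i := i + 1) (k := k) (y := x (i + 1) k + 1) (by omega) (by omega)
  simpa [site] using this

lemma IsLift.jump_injOn [NeZero N] (h : IsLift m₁ m₂ η x) (hs : IsStack N x i₀ H k₀) :
    Set.InjOn (jump (stack L N x i₀ H k₀)) η := by
  intro p hp p' hp' e
  rw [Finset.mem_coe] at hp hp'
  unfold jump at e
  split_ifs at e with h1 h2 h2
  · rw [Prod.mk.injEq] at e
    exact Prod.ext (add_right_cancel e.1) e.2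
  · exact absurd (e ▸ hp') (h.right_site_empty hs h1)
  · exact absurd (e ▸ hp) (h.right_site_empty hs h2)
  · exact e

lemma IsLift.prod_shift [NeZero N] (h : IsLift m₁ m₂ η x) (hs : IsStack N x i₀ H k₀)
    (f : Site L N → ℝ) : ∏ p ∈ shift η (site L N x (i₀ + 1) k₀), f p =
      ∏ p ∈ η, f (jump (stack L N x i₀ H k₀) p) := by
  rw [h.shift_eq_image hs, Finset.prod_image (h.jump_injOn hs)]

end Reindex

section Factors

variable {η' : Finset (Site L N)} {i : ℕ} {k : ℤ}

lemma IsLift.qPoch_gapA_move (h : IsLift m₁ m₂ η x) (hm₁ : 1 < m₁) (hs : IsStack N x i₀ H k₀)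
    (h' : IsLift m₁ m₂ η' (move L N x i₀ H k₀)) (hq0 : 0 ≤ q) (hq1 : q < 1) :
    qPoch q (gapA η' (site L N (move L N x i₀ H k₀) i k)) =
      qPoch q (gapA η (site L N x i k)) *
      (if site L N x i k ∈ stack L N x i₀ H k₀ then
        (1 - q ^ gapA η (site L N x i k))⁻¹ else 1) *
      (if site L N x i (k + 1) ∈ stack L N x i₀ H k₀ then
        1 - q ^ (gapA η (site L N x i k) + 1) else 1) := by
  have hA := h.gapA_site (L := L) (N := N) i k
  have hA' := h'.gapA_site (L := L) (N := N) i k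
  generalize gapA η (site L N x i k) = A at *
  generalize gapA η' (site L N (move L N x i₀ H k₀) i k) = A' at *
  have hR := h.right_not_mem_stack hm₁ hs (i := i) (k := k)
  by_cases h1 : site L N x i k ∈ stack L N x i₀ H k₀
  · rw [move_of_mem h1, move_of_not_mem (hR h1)] at hA'
    rw [if_pos h1, if_neg (hR h1), mul_one]
    obtain rfl : A = A' + 1 := by omega
    rw [qPoch_succ, mul_inv_cancel_right₀ (one_sub_pow_pos hq0 hq1 (Nat.succ_pos _)).ne']
  · by_cases h2 : site L N x i (k + 1) ∈ stack L N x i₀ H k₀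
    · rw [move_of_not_mem h1, move_of_mem h2] at hA'
      rw [if_neg h1, if_pos h2, mul_one]
      obtain rfl : A' = A + 1 := by omega
      rw [qPoch_succ]
    · rw [move_of_not_mem h1, move_of_not_mem h2] at hA'
      rw [if_neg h1, if_neg h2, mul_one, mul_one]
      obtain rfl : A' = A := by omega
      rfl

lemma IsLift.qPoch_gapB_move (h : IsLift m₁ m₂ η x) (hm₁ : 1 < m₁) (hs : IsStack N x i₀ H k₀)
    (h' : IsLift m₁ m₂ η' (move L N x i₀ H k₀)) (hq0 : 0 ≤ q) (hq1 : q < 1) :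
    (qPoch q (gapB η' (site L N (move L N x i₀ H k₀) (i + 1) k)))⁻¹ =
      (qPoch q (gapB η (site L N x (i + 1) k)))⁻¹ *
      (if site L N x (i + 1) k ∈ stack L N x i₀ H k₀ then
        1 - q ^ gapB η (site L N x (i + 1) k) else 1) *
      (if site L N x i (k + 1) ∈ stack L N x i₀ H k₀ then
        (1 - q ^ (gapB η (site L N x (i + 1) k) + 1))⁻¹ else 1) := by
  have hB := h.gapB_site (L := L) (N := N) i k
  have hB' := h'.gapB_site (L := L) (N := N) i k
  generalize gapB η (site L N x (i + 1) k) = B at *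
  generalize gapB η' (site L N (move L N x i₀ H k₀) (i + 1) k) = B' at *
  have hR := h.lowRight_not_mem_stack hm₁ hs (i := i) (k := k)
  by_cases h1 : site L N x (i + 1) k ∈ stack L N x i₀ H k₀
  · rw [move_of_mem h1, move_of_not_mem (hR h1)] at hB'
    rw [if_pos h1, if_neg (hR h1), mul_one]
    obtain rfl : B = B' + 1 := by omega
    rw [qPoch_succ, mul_inv,
      inv_mul_cancel_right₀ (one_sub_pow_pos hq0 hq1 (Nat.succ_pos _)).ne']
  · by_cases h2 : site L N x i (k + 1) ∈ stack L N x i₀ H k₀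
    · rw [move_of_not_mem h1, move_of_mem h2] at hB'
      rw [if_neg h1, if_pos h2, mul_one]
      obtain rfl : B' = B + 1 := by omega
      rw [qPoch_succ, mul_inv]
    · rw [move_of_not_mem h1, move_of_not_mem h2] at hB'
      rw [if_neg h1, if_neg h2, mul_one, mul_one]
      obtain rfl : B' = B := by omega
      rfl

lemma IsLift.qPoch_gapC_move (h : IsLift m₁ m₂ η x) (hs : IsStack N x i₀ H k₀)
    (h' : IsLift m₁ m₂ η' (move L N x i₀ H k₀)) (hq0 : 0 ≤ q) (hq1 : q < 1) {b : ℝ}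
    (hb : 0 < b) :
    b ^ gapC η' (site L N (move L N x i₀ H k₀) (i + 1) k) *
      (qPoch q (gapC η' (site L N (move L N x i₀ H k₀) (i + 1) k)))⁻¹ =
      b ^ gapC η (site L N x (i + 1) k) * (qPoch q (gapC η (site L N x (i + 1) k)))⁻¹ *
      (if site L N x (i + 1) k = site L N x (i₀ + 1) k₀ then
        b / (1 - q ^ (gapC η (site L N x (i + 1) k) + 1)) else 1) *
      (if site L N x (i + 1) k = site L N x (i₀ + 1 + H) k₀ then
        (1 - q ^ gapC η (site L N x (i + 1) k)) / b else 1) := by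
  have hC := h.gapC_site (L := L) (N := N) i k
  have hC' := h'.gapC_site (L := L) (N := N) i k
  generalize gapC η (site L N x (i + 1) k) = C at *
  generalize gapC η' (site L N (move L N x i₀ H k₀) (i + 1) k) = C' at *
  simp only [← h.bottom_iff hs, ← h.above_iff hs]
  by_cases h1 : site L N x (i + 1) k ∈ stack L N x i₀ H k₀ <;>
    by_cases h2 : site L N x i k ∈ stack L N x i₀ H k₀
  · rw [move_of_mem h1, move_of_mem h2] at hC'
    obtain rfl : C' = C := by omega
    simp [h1, h2]
  · rw [move_of_mem h1, move_of_not_mem h2] at hC'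
    obtain rfl : C' = C + 1 := by omega
    simp only [h1, h2, not_true_eq_false, not_false_eq_true, and_self, if_true, if_false,
      mul_one]
    rw [qPoch_succ, mul_inv, pow_succ]
    ring
  · rw [move_of_not_mem h1, move_of_mem h2] at hC'
    obtain rfl : C = C' + 1 := by omega
    simp only [h1, h2, not_true_eq_false, not_false_eq_true, and_self, if_true, if_false,
      mul_one]
    have := (one_sub_pow_pos hq0 hq1 (Nat.succ_pos C')).ne'
    have := (qPoch_pos hq0 hq1 C').ne'
    rw [qPoch_succ, mul_inv, pow_succ]
    field_simp
  · rw [move_of_not_mem h1, move_of_not_mem h2] at hC'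
    obtain rfl : C' = C := by omega
    simp [h1, h2]

end Factors

lemma prod_ite_mem_of_subset {α : Type*} [DecidableEq α] {s V : Finset α} (hV : V ⊆ s)
    (f : α → ℝ) : (∏ p ∈ s, if p ∈ V then f p else 1) = ∏ p ∈ V, f p := by
  rw [Finset.prod_ite_mem, Finset.inter_eq_right.2 hV]

lemma prod_range_div_of_eq_succ {u v : ℕ → ℝ} {n : ℕ} (huv : ∀ j < n, u (j + 1) = v j)
    (hv : ∀ j < n, v j ≠ 0) : ∏ j ∈ Finset.range (n + 1), u j / v j = u 0 / v n := by
  induction n with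
  | zero => simp
  | succ n ih =>
    rw [Finset.prod_range_succ, ih (fun j hj => huv j (by omega)) fun j hj => hv j (by omega),
      huv n (by omega), div_mul_div_cancel₀ (hv n (by omega))]

lemma IsStack.site_injOn (hs : IsStack N x i₀ H k₀) :
    Set.InjOn (fun j => site L N x (i₀ + 1 + j) k₀) (Finset.range H) := by
  intro j hj j' hj' e
  simp only [Finset.coe_range, Set.mem_Iio] at hj hj'
  have e : ((i₀ + 1 + j : ℕ) : ZMod N) = ((i₀ + 1 + j' : ℕ) : ZMod N) := congrArg Prod.snd e
  rw [ZMod.natCast_eq_natCast_iff] at e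
  have e := Nat.ModEq.add_left_cancel' _ e
  have := hs.lt_rows
  exact e.eq_of_lt_of_lt (by omega) (by omega)

lemma IsLift.gapA_pos_of_mem_stack [NeZero N] (h : IsLift m₁ m₂ η x) (hs : IsStack N x i₀ H k₀)
    {p : Site L N} (hp : p ∈ stack L N x i₀ H k₀) : 0 < gapA η p := by
  obtain ⟨i, k, rfl⟩ := h.exists_site_succ (h.stack_subset hp)
  have h1 := h.free_of_mem_stack hs hp
  have h2 := h.le_up i (k + 1)
  have h3 := h.gapA_site (i + 1) k
  omega

/-- The change of the weight under the move of a stack, before telescoping along the stack. -/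
lemma IsLift.weight_shift [NeZero N] (h : IsLift m₁ m₂ η x) (hm₁ : 1 < m₁)
    (hs : IsStack N x i₀ H k₀) (hq0 : 0 ≤ q) (hq1 : q < 1) (ha : ∀ i, 0 < a i) :
    weight q a (shift η (site L N x (i₀ + 1) k₀)) = weight q a η *
      (a (site L N x (i₀ + 1) k₀).2 / (1 - q ^ (gapC η (site L N x (i₀ + 1) k₀) + 1))) *
      ((1 - q ^ gapC η (site L N x (i₀ + 1 + H) k₀)) / a (site L N x (i₀ + 1 + H) k₀).2) *
      ∏ p ∈ stack L N x i₀ H k₀, ((1 - q ^ gapB η p) * (1 - q ^ (gapD η p + 1)) /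
        ((1 - q ^ gapA η p) * (1 - q ^ (gapE η p + 1)))) := by
  have h' := h.isLift_move hs
  set V := stack L N x i₀ H k₀ with hV
  have hfac : ∀ p ∈ η, a (jump V p).2 ^ gapC (shift η (site L N x (i₀ + 1) k₀)) (jump V p) *
      (qPoch q (gapA (shift η (site L N x (i₀ + 1) k₀)) (jump V p)) /
        (qPoch q (gapB (shift η (site L N x (i₀ + 1) k₀)) (jump V p)) *
          qPoch q (gapC (shift η (site L N x (i₀ + 1) k₀)) (jump V p)))) =
      a p.2 ^ gapC η p * (qPoch q (gapA η p) / (qPoch q (gapB η p) * qPoch q (gapC η p))) *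
      (if p = site L N x (i₀ + 1) k₀ then a p.2 / (1 - q ^ (gapC η p + 1)) else 1) *
      (if p = site L N x (i₀ + 1 + H) k₀ then (1 - q ^ gapC η p) / a p.2 else 1) *
      (((if p ∈ V then (1 - q ^ gapB η p) / (1 - q ^ gapA η p) else 1) *
      (if rightN η p ∈ V then 1 - q ^ (gapD η (rightN η p) + 1) else 1)) *
      (if lowRight η p ∈ V then (1 - q ^ (gapE η (lowRight η p) + 1))⁻¹ else 1)) := by
    intro p hp
    obtain ⟨i, k, rfl⟩ := h.exists_site_succ hp
    have hA := h.qPoch_gapA_move hm₁ hs h' hq0 hq1 (i := i + 1) (k := k)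
    have hB := h.qPoch_gapB_move hm₁ hs h' hq0 hq1 (i := i) (k := k)
    have hC := h.qPoch_gapC_move hs h' hq0 hq1 (i := i) (k := k)
      (ha (site L N x (i + 1) k).2)
    have hD : gapD η (site L N x (i + 1) (k + 1)) = gapA η (site L N x (i + 1) k) := by
      have := h.gapD_site (L := L) (N := N) (i + 1) (k + 1)
      have := h.gapA_site (L := L) (N := N) (i + 1) k
      rw [add_sub_cancel_right] at *
      omega
    have hE : gapE η (site L N x i (k + 1)) = gapB η (site L N x (i + 1) k) := by
      have := h.gapE_site (L := L) (N := N) i (k + 1)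
      have := h.gapB_site (L := L) (N := N) i k
      rw [add_sub_cancel_right] at *
      omega
    rw [hV, jump_site, h.rightN_site, h.lowRight_site, hD, hE]
    rw [show (site L N (move L N x i₀ H k₀) (i + 1) k).2 = (site L N x (i + 1) k).2 from rfl]
    rw [div_eq_mul_inv, mul_inv, mul_left_comm, mul_left_comm _ (qPoch q _)⁻¹, hC, hB, hA]
    by_cases h1 : site L N x (i + 1) k ∈ stack L N x i₀ H k₀
    · simp only [if_pos h1]; ring
    · simp only [if_neg h1]; ring
  rw [weight, h.prod_shift hs, Finset.prod_congr rfl hfac]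
  simp only [Finset.prod_mul_distrib]
  rw [h.prod_rightN (fun p => if p ∈ V then 1 - q ^ (gapD η p + 1) else 1),
    h.prod_lowRight (fun p => if p ∈ V then (1 - q ^ (gapE η p + 1))⁻¹ else 1),
    prod_ite_mem_of_subset h.stack_subset, prod_ite_mem_of_subset h.stack_subset,
    prod_ite_mem_of_subset h.stack_subset, Finset.prod_ite_eq', Finset.prod_ite_eq',
    if_pos (h.site_mem _ _), if_pos (h.site_mem _ _), weight,
    ← Finset.prod_mul_distrib, ← Finset.prod_mul_distrib]
  congr 1
  rw [← Finset.prod_mul_distrib]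
  refine Finset.prod_congr rfl fun p _ => ?_
  rw [div_mul_eq_mul_div, ← div_eq_mul_inv, div_div]

/-- The rate of the reversed dynamics. -/
noncomputable def reverseRate (q : ℝ) (a : ZMod N → ℝ) (η : Finset (Site L N)) (p : Site L N) : ℝ :=
  a (p.2 + 1) * ((1 - q ^ gapE η p) * (1 - q ^ (gapA η p + 1)) / (1 - q ^ (gapF η p + 1)))

lemma IsLift.prod_stack [NeZero N] (h : IsLift m₁ m₂ η x) (hs : IsStack N x i₀ (H + 1) k₀)
    (hq0 : 0 ≤ q) (hq1 : q < 1) :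
    ∏ p ∈ stack L N x i₀ (H + 1) k₀, ((1 - q ^ gapB η p) * (1 - q ^ (gapD η p + 1)) /
        ((1 - q ^ gapA η p) * (1 - q ^ (gapE η p + 1)))) =
      (1 - q ^ gapB η (site L N x (i₀ + 1) k₀)) *
        (1 - q ^ (gapD η (site L N x (i₀ + 1) k₀) + 1)) /
      ((1 - q ^ gapA η (site L N x (i₀ + 1 + H) k₀)) *
        (1 - q ^ (gapE η (site L N x (i₀ + 1 + H) k₀) + 1))) := by
  rw [stack, Finset.prod_image hs.site_injOn]
  refine prod_range_div_of_eq_succ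
    (u := fun j => (1 - q ^ gapB η (site L N x (i₀ + 1 + j) k₀)) *
        (1 - q ^ (gapD η (site L N x (i₀ + 1 + j) k₀) + 1)))
    (v := fun j => (1 - q ^ gapA η (site L N x (i₀ + 1 + j) k₀)) *
        (1 - q ^ (gapE η (site L N x (i₀ + 1 + j) k₀) + 1))) (fun j hj => ?_) fun j hj => ?_
  · have h1 := hs.eq j (by omega)
    have h2 := hs.eq (j + 1) (by omega)
    rw [← add_assoc (i₀ + 1)] at h2
    have hA := h.gapA_site (L := L) (N := N) (i₀ + 1 + j) k₀
    have hB := h.gapB_site (L := L) (N := N) (i₀ + 1 + j) k₀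
    have hE := h.gapE_site (L := L) (N := N) (i₀ + 1 + j) k₀
    have hD := h.gapD_site (L := L) (N := N) (i₀ + 1 + j + 1) k₀
    simp only [← add_assoc (i₀ + 1) j 1]
    congr 3
    · omega
    · congr 1; omega
  · exact mul_ne_zero
      (one_sub_pow_pos hq0 hq1
        (h.gapA_pos_of_mem_stack hs (mem_stack.2 ⟨j, by omega, rfl⟩))).ne'
      (one_sub_pow_pos hq0 hq1 (Nat.succ_pos _)).ne'

/-- Time reversal of the moves with respect to the weight. -/
theorem IsLift.weight_mul_rate [NeZero N] (h : IsLift m₁ m₂ η x) (hm₁ : 1 < m₁)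
    (hs : IsStack N x i₀ (H + 1) k₀) (hq0 : 0 ≤ q) (hq1 : q < 1) (ha : ∀ i, 0 < a i) :
    weight q a η * rate q a η (site L N x (i₀ + 1) k₀) =
      weight q a (shift η (site L N x (i₀ + 1) k₀)) *
        reverseRate q a (shift η (site L N x (i₀ + 1) k₀))
          (site L N (move L N x i₀ (H + 1) k₀) (i₀ + 1 + H) k₀) := by
  have h' := h.isLift_move hs
  have htop : site L N x (i₀ + 1 + H) k₀ ∈ stack L N x i₀ (H + 1) k₀ :=
    mem_stack.2 ⟨H, by omega, rfl⟩
  have hApos := h.gapA_pos_of_mem_stack hs htop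
  have habove := ((h.above_iff hs (i := i₀ + 1 + H) (k := k₀)).2 rfl).1
  have hright := h.right_not_mem_stack hm₁ hs htop
  have hupleft : site L N x (i₀ + 1 + H + 1) (k₀ - 1) ∉ stack L N x i₀ (H + 1) k₀ := fun hc =>
    h.lowRight_not_mem_stack hm₁ hs hc (by rwa [sub_add_cancel])
  have hX := hs.eq H (by omega)
  have hlt := hs.lt_top
  rw [← add_assoc (i₀ + 1)] at hlt
  have hA := h.gapA_site (L := L) (N := N) (i₀ + 1 + H) k₀
  have hE := h.gapE_site (L := L) (N := N) (i₀ + 1 + H) k₀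
  have hC := h.gapC_site (L := L) (N := N) (i₀ + 1 + H) k₀
  have hA' := h'.gapA_site (L := L) (N := N) (i₀ + 1 + H) k₀
  have hE' := h'.gapE_site (L := L) (N := N) (i₀ + 1 + H) k₀
  have hF' := h'.gapF_site (L := L) (N := N) (i₀ + 1 + H) k₀
  rw [move_of_mem htop, move_of_not_mem hright] at hA'
  rw [move_of_mem htop, move_of_not_mem hupleft] at hE'
  rw [move_of_mem htop, move_of_not_mem habove] at hF'
  rw [h.weight_shift hm₁ hs hq0 hq1 ha, h.prod_stack hs hq0 hq1, rate, reverseRate]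
  rw [show (site L N (move L N x i₀ (H + 1) k₀) (i₀ + 1 + H) k₀).2 + 1 =
    (site L N x (i₀ + 1 + (H + 1)) k₀).2 by simp [site, add_assoc]]
  rw [← add_assoc (i₀ + 1) H 1]
  have e1 : gapE (shift η (site L N x (i₀ + 1) k₀))
      (site L N (move L N x i₀ (H + 1) k₀) (i₀ + 1 + H) k₀) =
      gapE η (site L N x (i₀ + 1 + H) k₀) + 1 := by omega
  have e2 : gapA (shift η (site L N x (i₀ + 1) k₀))
      (site L N (move L N x i₀ (H + 1) k₀) (i₀ + 1 + H) k₀) + 1 =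
      gapA η (site L N x (i₀ + 1 + H) k₀) := by omega
  have e3 : gapF (shift η (site L N x (i₀ + 1) k₀))
      (site L N (move L N x i₀ (H + 1) k₀) (i₀ + 1 + H) k₀) + 1 =
      gapC η (site L N x (i₀ + 1 + H + 1) k₀) := by omega
  rw [e1, e2, e3]
  have n1 := (one_sub_pow_pos hq0 hq1 hApos).ne'
  have n2 := (one_sub_pow_pos hq0 hq1
    (Nat.succ_pos (gapE η (site L N x (i₀ + 1 + H) k₀)))).ne'
  have n3 := (one_sub_pow_pos hq0 hq1
    (show 0 < gapC η (site L N x (i₀ + 1 + H + 1) k₀) by omega)).ne'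
  have n4 := (ha (site L N x (i₀ + 1 + H + 1) k₀).2).ne'
  have n5 := (one_sub_pow_pos hq0 hq1
    (Nat.succ_pos (gapC η (site L N x (i₀ + 1) k₀)))).ne'
  rw [Nat.succ_eq_add_one] at n2 n5
  generalize 1 - q ^ gapA η (site L N x (i₀ + 1 + H) k₀) = t1 at *
  generalize 1 - q ^ (gapE η (site L N x (i₀ + 1 + H) k₀) + 1) = t2 at *
  generalize 1 - q ^ gapC η (site L N x (i₀ + 1 + H + 1) k₀) = t3 at *
  generalize a (site L N x (i₀ + 1 + H + 1) k₀).2 = t4 at *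
  generalize 1 - q ^ (gapC η (site L N x (i₀ + 1) k₀) + 1) = t5 at *
  field_simp

end QWhittaker

namespace QWhittaker

variable {L N m₁ m₂ : ℕ} {η : Finset (Site L N)} {x : ℕ → ℤ → ℤ} {i₀ H : ℕ} {k₀ : ℤ}
  {q : ℝ} {a : ZMod N → ℝ}

section Rates

lemma rate_nonneg (hq0 : 0 ≤ q) (hq1 : q < 1) (ha : ∀ i, 0 < a i) (p : Site L N) :
    0 ≤ rate q a η p :=
  mul_nonneg (ha _).le (div_nonneg (mul_nonneg (one_sub_pow_nonneg hq0 hq1 _)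
    (one_sub_pow_nonneg hq0 hq1 _)) (one_sub_pow_nonneg hq0 hq1 _))

lemma reverseRate_nonneg (hq0 : 0 ≤ q) (hq1 : q < 1) (ha : ∀ i, 0 < a i) (p : Site L N) :
    0 ≤ reverseRate q a η p :=
  mul_nonneg (ha _).le (div_nonneg (mul_nonneg (one_sub_pow_nonneg hq0 hq1 _)
    (one_sub_pow_nonneg hq0 hq1 _)) (one_sub_pow_nonneg hq0 hq1 _))

lemma rate_eq_zero {p : Site L N} (hp : gapB η p = 0) : rate q a η p = 0 := by
  simp [rate, hp]

lemma weight_pos (hq0 : 0 ≤ q) (hq1 : q < 1) (ha : ∀ i, 0 < a i) : 0 < weight q a η :=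
  Finset.prod_pos fun _ _ => mul_pos (pow_pos (ha _) _)
    (div_pos (qPoch_pos hq0 hq1 _) (mul_pos (qPoch_pos hq0 hq1 _) (qPoch_pos hq0 hq1 _)))

/-- The exit rates of the dynamics and of the reversed dynamics agree. -/
theorem IsLift.sum_reverseRate [NeZero N] (h : IsLift m₁ m₂ η x) (hq0 : 0 ≤ q) (hq1 : q < 1) :
    ∑ p ∈ η, reverseRate q a η p = ∑ p ∈ η, rate q a η p := by
  set f : Site L N → ℝ := fun p => a p.2 * q ^ gapE η (lowLeft η p) with hf
  have key : ∀ p ∈ η, rate q a η p =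
      reverseRate q a η (lowLeft η p) + f p - f (rightN η p) := by
    intro p hp
    obtain ⟨i, k, rfl⟩ := h.exists_site_succ hp
    have hA := h.gapA_site (L := L) (N := N) i k
    have hB := h.gapB_site (L := L) (N := N) i k
    have hC := h.gapC_site (L := L) (N := N) i k
    have hD := h.gapD_site (L := L) (N := N) (i + 1) k
    have hF := h.gapF_site (L := L) (N := N) i k
    have hE := h.gapE_site (L := L) (N := N) i k
    have hE' := h.gapE_site (L := L) (N := N) i (k + 1)
    rw [add_sub_cancel_right] at hE'
    simp only [hf, h.rightN_site, h.lowLeft_site, rate, reverseRate]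
    rw [show gapD η (site L N x (i + 1) k) + 1 =
        gapE η (site L N x i k) + (gapC η (site L N x (i + 1) k) + 1) by omega,
      show gapA η (site L N x i k) + 1 =
        gapB η (site L N x (i + 1) k) + (gapC η (site L N x (i + 1) k) + 1) by omega,
      show gapF η (site L N x i k) = gapC η (site L N x (i + 1) k) by omega,
      show gapE η (site L N x i (k + 1)) = gapB η (site L N x (i + 1) k) by omega,
      show (site L N x i k).2 + 1 = (site L N x (i + 1) k).2 by simp [site],
      show (site L N x (i + 1) (k + 1)).2 = (site L N x (i + 1) k).2 from rfl]
    have hne := (one_sub_pow_pos hq0 hq1 (Nat.succ_pos (gapC η (site L N x (i + 1) k)))).ne'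
    rw [Nat.succ_eq_add_one] at hne
    rw [pow_add q (gapE _ _), pow_add q (gapB _ _)]
    field_simp
    ring
  rw [Finset.sum_congr rfl key, Finset.sum_sub_distrib, Finset.sum_add_distrib, h.sum_lowLeft,
    h.sum_rightN, add_sub_cancel_right]

end Rates

section Reversal

/-- The site reached by the highest particle of the stack above `p` when the stack moves. -/
def IsTop (m₁ m₂ : ℕ) (η : Finset (Site L N)) (p s : Site L N) : Prop :=
  ∃ x i₀ H k₀, IsLift m₁ m₂ η x ∧ IsStack N x i₀ (H + 1) k₀ ∧ p = site L N x (i₀ + 1) k₀ ∧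
    s = site L N (move L N x i₀ (H + 1) k₀) (i₀ + 1 + H) k₀

lemma IsConfig.exists_isTop [NeZero L] [NeZero N] (hη : IsConfig m₁ m₂ η) (hm₁ : 1 < m₁)
    (hm₂ : 1 ≤ m₂) {p : Site L N} (hp : p ∈ η) (hB : 0 < gapB η p) : ∃ s, IsTop m₁ m₂ η p s := by
  obtain ⟨x, h⟩ := hη.exists_isLift (by omega)
  obtain ⟨i₀, k₀, rfl⟩ := h.exists_site_succ hp
  obtain ⟨H, hs⟩ := h.exists_isStack hm₂ hB
  obtain ⟨H, rfl⟩ : ∃ H', H = H' + 1 := ⟨H - 1, by have := hs.pos; omega⟩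
  exact ⟨_, x, i₀, H, k₀, h, hs, rfl, rfl⟩

lemma IsTop.isConfig_shift [NeZero L] [NeZero N] {p s : Site L N} (hs : IsTop m₁ m₂ η p s)
    (hm₁ : 0 < m₁) : IsConfig m₁ m₂ (shift η p) := by
  obtain ⟨x, i₀, H, k₀, h, hs, rfl, rfl⟩ := hs
  exact (h.isLift_move hs).isConfig hm₁

lemma IsTop.mem_shift {p s : Site L N} (hs : IsTop m₁ m₂ η p s) : s ∈ shift η p := by
  obtain ⟨x, i₀, H, k₀, h, hs, rfl, rfl⟩ := hs
  exact (h.isLift_move hs).site_mem _ _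

lemma IsTop.weight_mul_rate [NeZero N] {p s : Site L N} (hs : IsTop m₁ m₂ η p s)
    (hm₁ : 1 < m₁) (hq0 : 0 ≤ q) (hq1 : q < 1) (ha : ∀ i, 0 < a i) :
    weight q a η * rate q a η p = weight q a (shift η p) * reverseRate q a (shift η p) s := by
  obtain ⟨x, i₀, H, k₀, h, hs, rfl, rfl⟩ := hs
  exact h.weight_mul_rate hm₁ hs hq0 hq1 ha

/-- A stack is recovered from its highest particle after the move and its height. -/
lemma IsTop.recover [NeZero N] {p s : Site L N} (hs : IsTop m₁ m₂ η p s) :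
    ∃ H : ℕ, (∀ j ≤ H, (s.1, s.2 - (j : ZMod N)) ∈ shift η p) ∧
      (s.1, s.2 - ((H + 1 : ℕ) : ZMod N)) ∉ shift η p ∧
      p = (s.1 - 1, s.2 - (H : ZMod N)) ∧
      η = (shift η p \ (Finset.range (H + 1)).image (fun j : ℕ => (s.1, s.2 - (j : ZMod N)))) ∪
        (Finset.range (H + 1)).image (fun j : ℕ => (s.1 - 1, s.2 - (j : ZMod N))) := by
  obtain ⟨x, i₀, H, k₀, h, hs, rfl, rfl⟩ := hs
  have h' := h.isLift_move hs
  have htop : site L N (move L N x i₀ (H + 1) k₀) (i₀ + 1 + H) k₀ =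
      (((x (i₀ + 1) k₀ + 1 : ℤ) : ZMod L), ((i₀ + 1 + H : ℕ) : ZMod N)) := by
    rw [site, move_of_mem (mem_stack.2 ⟨H, by omega, rfl⟩), hs.eq H (by omega)]
  have hmem : ∀ j ≤ H, site L N x (i₀ + 1 + (H - j)) k₀ =
      (((x (i₀ + 1) k₀ : ℤ) : ZMod L), ((i₀ + 1 + H : ℕ) : ZMod N) - (j : ZMod N)) := by
    intro j hj
    rw [site, hs.eq _ (by omega), Prod.mk.injEq, ← Nat.cast_sub (by omega)]
    exact ⟨rfl, by congr 1; omega⟩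
  have himage : (Finset.range (H + 1)).image (fun j : ℕ => ((((x (i₀ + 1) k₀ : ℤ) : ZMod L),
      ((i₀ + 1 + H : ℕ) : ZMod N) - (j : ZMod N)) : Site L N)) = stack L N x i₀ (H + 1) k₀ := by
    ext p
    rw [mem_stack, Finset.mem_image]
    constructor
    · rintro ⟨j, hj, rfl⟩
      rw [Finset.mem_range] at hj
      exact ⟨H - j, by omega, (hmem j (by omega)).symm⟩
    · rintro ⟨j, hj, rfl⟩
      refine ⟨H - j, Finset.mem_range.2 (by omega), ?_⟩
      rw [← hmem _ (by omega), show H - (H - j) = j by omega]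
  have himage' : (Finset.range (H + 1)).image
      (fun j : ℕ => ((((x (i₀ + 1) k₀ + 1 : ℤ) : ZMod L),
        ((i₀ + 1 + H : ℕ) : ZMod N) - (j : ZMod N)) : Site L N)) =
      (stack L N x i₀ (H + 1) k₀).image (fun s => (s.1 + 1, s.2)) := by
    rw [← himage, Finset.image_image]
    refine congrArg (fun f => Finset.image f _) (funext fun j => ?_)
    simp
  have hshift : shift η (site L N x (i₀ + 1) k₀) = (η \ stack L N x i₀ (H + 1) k₀) ∪
      (stack L N x i₀ (H + 1) k₀).image (fun s => (s.1 + 1, s.2)) := by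
    rw [shift, h.family_eq_stack hs]
  rw [htop]
  refine ⟨H, fun j hj => ?_, ?_, ?_, ?_⟩
  · rw [hshift, ← himage']
    exact Finset.mem_union_right _ (Finset.mem_image.2 ⟨j, Finset.mem_range.2 (by omega), rfl⟩)
  · rw [← Nat.cast_sub (by omega), show i₀ + 1 + H - (H + 1) = i₀ by omega]
    refine h'.not_mem_of_lt_of_lt (k := k₀) ?_ ?_
    · rw [move_of_not_mem (IsLift.low_not_mem_stack hs)]
      have := h.le_up i₀ k₀
      omega
    · refine hs.free.trans_le ?_
      simp only [move]
      split_ifs <;> omega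
  · have := hmem H le_rfl
    rw [Nat.sub_self, add_zero] at this
    rw [this]
    simp
  · have e : (((x (i₀ + 1) k₀ + 1 : ℤ) : ZMod L) - 1) = ((x (i₀ + 1) k₀ : ℤ) : ZMod L) := by
      push_cast; ring
    simp only [e]
    rw [himage, himage', hshift]
    ext p
    simp only [Finset.mem_union, Finset.mem_sdiff]
    have h1 : p ∈ stack L N x i₀ (H + 1) k₀ → p ∈ η := fun hp => h.stack_subset hp
    have h2 : p ∈ (stack L N x i₀ (H + 1) k₀).image (fun s => (s.1 + 1, s.2)) → p ∉ η := by
      rw [Finset.mem_image]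
      rintro ⟨s, hs', rfl⟩
      exact h.right_site_empty hs hs'
    tauto

lemma IsTop.inj [NeZero N] {η₁ η₂ : Finset (Site L N)} {p₁ p₂ s : Site L N}
    (h₁ : IsTop m₁ m₂ η₁ p₁ s) (h₂ : IsTop m₁ m₂ η₂ p₂ s) (e : shift η₁ p₁ = shift η₂ p₂) :
    η₁ = η₂ ∧ p₁ = p₂ := by
  obtain ⟨H₁, a₁, b₁, c₁, d₁⟩ := h₁.recover
  obtain ⟨H₂, a₂, b₂, c₂, d₂⟩ := h₂.recover
  obtain rfl : H₁ = H₂ := by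
    rcases lt_trichotomy H₁ H₂ with hlt | heq | hlt
    · exact absurd (e ▸ a₂ (H₁ + 1) hlt) b₁
    · exact heq
    · exact absurd (e ▸ a₁ (H₂ + 1) hlt) b₂
  exact ⟨by rw [d₁, d₂, e], by rw [c₁, c₂]⟩

end Reversal

section Stationarity

lemma vecMul_exp_of_vecMul_eq_zero {ι : Type*} [Fintype ι] [DecidableEq ι] {A : Matrix ι ι ℝ}
    {v : ι → ℝ} (h : Matrix.vecMul v A = 0) : Matrix.vecMul v (NormedSpace.exp A) = v := by
  let _ : NormedRing (Matrix ι ι ℝ) := Matrix.linftyOpNormedRing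
  let _ : NormedAlgebra ℝ (Matrix ι ι ℝ) := Matrix.linftyOpNormedAlgebra
  have hs := NormedSpace.exp_series_hasSum_exp' (𝕂 := ℝ) A
  let φ : Matrix ι ι ℝ →ₗ[ℝ] (ι → ℝ) :=
    { toFun := fun B => Matrix.vecMul v B
      map_add' := fun B C => Matrix.vecMul_add B C v
      map_smul' := fun c B => Matrix.vecMul_smul v c B }
  have h1 := hs.mapL φ.toContinuousLinearMap
  have h2 : HasSum (fun n : ℕ => φ.toContinuousLinearMap (((n.factorial : ℝ))⁻¹ • A ^ n)) v := by
    convert hasSum_single 0 fun n hn => ?_ using 1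
    · simp [φ]
    · obtain ⟨n, rfl⟩ := Nat.exists_eq_succ_of_ne_zero hn
      simp [φ, pow_succ', ← Matrix.vecMul_vecMul, h]
  exact h1.unique h2

variable [NeZero L] [NeZero N]

/-- The total weighted rate of the moves into `η`. -/
noncomputable def inflow (m₁ m₂ : ℕ) (q : ℝ) (a : ZMod N → ℝ) (η : Finset (Site L N)) : ℝ :=
  ∑ σ : Config L N m₁ m₂, ∑ p ∈ σ.1,
    weight q a σ.1 * rate q a σ.1 p * if shift σ.1 p = η then 1 else 0

lemma inflow_le (hm₁ : 1 < m₁) (hm₂ : 1 ≤ m₂) (hq0 : 0 ≤ q) (hq1 : q < 1) (ha : ∀ i, 0 < a i)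
    (hη : IsConfig m₁ m₂ η) :
    inflow m₁ m₂ q a η ≤ weight q a η * ∑ p ∈ η, rate q a η p := by
  classical
  obtain ⟨x, h⟩ := hη.exists_isLift (by omega)
  set T : Finset (Σ _ : Config L N m₁ m₂, Site L N) :=
    ((Finset.univ : Finset (Config L N m₁ m₂)).sigma fun σ => σ.1).filter
      fun z => 0 < gapB z.1.1 z.2 ∧ shift z.1.1 z.2 = η with hT
  have hT_top : ∀ z : Σ _ : Config L N m₁ m₂, Site L N, ∃ s, z ∈ T →
      IsTop m₁ m₂ z.1.1 z.2 s := by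
    intro z
    by_cases hz : z ∈ T
    · have hz' := hz
      simp only [hT, Finset.mem_filter, Finset.mem_sigma, Finset.mem_univ, true_and] at hz'
      obtain ⟨s, hs⟩ := z.1.2.exists_isTop hm₁ hm₂ hz'.1 hz'.2.1
      exact ⟨s, fun _ => hs⟩
    · exact ⟨z.2, fun hz' => absurd hz' hz⟩
  choose t ht using hT_top
  have hT_shift : ∀ z ∈ T, shift z.1.1 z.2 = η := fun z hz => (Finset.mem_filter.1 hz).2.2
  have hinj : Set.InjOn t T := by
    rintro ⟨σ, p⟩ hz ⟨σ', p'⟩ hz' e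
    have h1 := ht _ hz
    rw [e] at h1
    obtain ⟨e1, e2⟩ := h1.inj (ht _ hz') ((hT_shift _ hz).trans (hT_shift _ hz').symm)
    obtain rfl : σ = σ' := Subtype.ext e1
    obtain rfl : p = p' := e2
    rfl
  calc inflow m₁ m₂ q a η
      = ∑ z ∈ T, weight q a η * reverseRate q a η (t z) := by
        rw [inflow, Finset.sum_sigma', hT]
        rw [← Finset.sum_filter_of_ne (p := fun z => 0 < gapB z.1.1 z.2 ∧ shift z.1.1 z.2 = η)]
        · refine Finset.sum_congr rfl fun z hz => ?_
          rw [← hT] at hz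
          rw [(ht z hz).weight_mul_rate hm₁ hq0 hq1 ha, hT_shift z hz, if_pos rfl, mul_one]
        · intro z _ hz
          refine ⟨Nat.pos_of_ne_zero fun h0 => hz ?_, ?_⟩
          · rw [rate_eq_zero h0, mul_zero, zero_mul]
          · by_contra hc
            exact hz (by rw [if_neg hc, mul_zero])
    _ = ∑ s ∈ T.image t, weight q a η * reverseRate q a η s := by
        rw [Finset.sum_image hinj]
    _ ≤ ∑ s ∈ η, weight q a η * reverseRate q a η s := by
        refine Finset.sum_le_sum_of_subset_of_nonneg (fun s hs => ?_) fun s _ _ =>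
          mul_nonneg (weight_pos hq0 hq1 ha).le (reverseRate_nonneg hq0 hq1 ha s)
        obtain ⟨z, hz, rfl⟩ := Finset.mem_image.1 hs
        exact hT_shift z hz ▸ (ht z hz).mem_shift
    _ = weight q a η * ∑ p ∈ η, rate q a η p := by
        rw [← Finset.mul_sum, h.sum_reverseRate hq0 hq1]

lemma sum_inflow (hm₁ : 1 < m₁) (hm₂ : 1 ≤ m₂) :
    ∑ η : Config L N m₁ m₂, inflow m₁ m₂ q a η.1 =
      ∑ η : Config L N m₁ m₂, weight q a η.1 * ∑ p ∈ η.1, rate q a η.1 p := by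
  simp only [inflow]
  rw [Finset.sum_comm]
  refine Finset.sum_congr rfl fun σ _ => ?_
  rw [Finset.sum_comm, Finset.mul_sum]
  refine Finset.sum_congr rfl fun p hp => ?_
  rw [← Finset.mul_sum]
  rcases Nat.eq_zero_or_pos (gapB σ.1 p) with h0 | h0
  · rw [rate_eq_zero h0, mul_zero, zero_mul]
  · obtain ⟨s, hs⟩ := σ.2.exists_isTop hm₁ hm₂ hp h0
    rw [Finset.sum_eq_single ⟨shift σ.1 p, hs.isConfig_shift (by omega)⟩, if_pos rfl, mul_one]
    · intro τ _ hτ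
      exact if_neg fun e => hτ (Subtype.ext e.symm)
    · intro hc
      exact absurd (Finset.mem_univ _) hc

/-- The balance equation. -/
theorem inflow_eq (hm₁ : 1 < m₁) (hm₂ : 1 ≤ m₂) (hq0 : 0 ≤ q) (hq1 : q < 1) (ha : ∀ i, 0 < a i)
    (η : Config L N m₁ m₂) :
    inflow m₁ m₂ q a η.1 = weight q a η.1 * ∑ p ∈ η.1, rate q a η.1 p :=
  (Finset.sum_eq_sum_iff_of_le fun η _ => inflow_le hm₁ hm₂ hq0 hq1 ha η.2).1
    (sum_inflow hm₁ hm₂) η (Finset.mem_univ η)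

theorem vecMul_gibbs_generator (hm₁ : 1 < m₁) (hm₂ : 1 ≤ m₂) (hq0 : 0 ≤ q) (hq1 : q < 1)
    (ha : ∀ i, 0 < a i) :
    Matrix.vecMul (gibbs L N m₁ m₂ q a) (generator L N m₁ m₂ q a) = 0 := by
  ext η
  have hZ : Matrix.vecMul (gibbs L N m₁ m₂ q a) (generator L N m₁ m₂ q a) η =
      (∑ τ : Config L N m₁ m₂, weight q a τ.1)⁻¹ *
        (inflow m₁ m₂ q a η.1 - weight q a η.1 * ∑ p ∈ η.1, rate q a η.1 p) := by
    have hout : weight q a η.1 * ∑ p ∈ η.1, rate q a η.1 p = ∑ σ : Config L N m₁ m₂,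
        ∑ p ∈ σ.1, weight q a σ.1 * rate q a σ.1 p * if σ = η then 1 else 0 := by
      rw [Finset.sum_eq_single η]
      · simp [Finset.mul_sum]
      · intro σ _ hσ
        simp [hσ]
      · intro hc
        exact absurd (Finset.mem_univ _) hc
    rw [hout, inflow, ← Finset.sum_sub_distrib, Finset.mul_sum]
    refine Finset.sum_congr rfl fun σ _ => ?_
    rw [← Finset.sum_sub_distrib, Finset.mul_sum]
    unfold generator
    rw [Finset.mul_sum]
    refine Finset.sum_congr rfl fun p _ => ?_
    rw [gibbs]
    ring
  rw [hZ, inflow_eq hm₁ hm₂ hq0 hq1 ha η, sub_self, mul_zero]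
  rfl

end Stationarity

end QWhittaker

theorem theorem1 (L N m₁ m₂ : ℕ) [NeZero L] [NeZero N]
    (hm₁ : 1 < m₁) (hm₁L : m₁ < L) (hm₂ : 1 ≤ m₂) (hm₂N : m₂ < N)
    (hm : (m₁ : ℝ) / L + (m₂ : ℝ) / N < 1)
    (q : ℝ) (hq0 : 0 ≤ q) (hq1 : q < 1)
    (a : ZMod N → ℝ) (ha : ∀ i, 0 < a i) :
    -- every move of positive rate stays in the sector
    (∀ σ : QWhittaker.Config L N m₁ m₂, ∀ p ∈ σ.1,
      0 ≤ QWhittaker.rate q a σ.1 p ∧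
      (0 < QWhittaker.rate q a σ.1 p →
        QWhittaker.IsConfig m₁ m₂ (QWhittaker.shift σ.1 p))) ∧
    -- the Gibbs measure is a probability law on the sector
    (∀ σ : QWhittaker.Config L N m₁ m₂, 0 ≤ QWhittaker.gibbs L N m₁ m₂ q a σ) ∧
    (∑ σ : QWhittaker.Config L N m₁ m₂, QWhittaker.gibbs L N m₁ m₂ q a σ = 1) ∧
    -- the Gibbs measure is stationary in time
    (∀ t : ℝ, 0 ≤ t →
      Matrix.vecMul (QWhittaker.gibbs L N m₁ m₂ q a) (QWhittaker.semigroup L N m₁ m₂ q a t) =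
        QWhittaker.gibbs L N m₁ m₂ q a) := by
  have hw : ∀ η : Finset (QWhittaker.Site L N), 0 < QWhittaker.weight q a η :=
    fun _ => QWhittaker.weight_pos hq0 hq1 ha
  have := QWhittaker.nonempty_config (L := L) (N := N) (m₂ := m₂) (by omega : 0 < m₁) hm
  refine ⟨fun σ p hp => ⟨QWhittaker.rate_nonneg hq0 hq1 ha p, fun hr => ?_⟩, fun σ => ?_, ?_,
    fun t _ => ?_⟩
  · have hB : 0 < QWhittaker.gapB σ.1 p :=
      Nat.pos_of_ne_zero fun h0 => hr.ne' (QWhittaker.rate_eq_zero h0)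
    obtain ⟨s, hs⟩ := σ.2.exists_isTop hm₁ hm₂ hp hB
    exact hs.isConfig_shift (by omega)
  · exact div_nonneg (hw _).le (Finset.sum_nonneg fun τ _ => (hw _).le)
  · simp only [QWhittaker.gibbs]
    rw [← Finset.sum_div]
    exact div_self (Finset.sum_pos (fun τ _ => hw τ.1) Finset.univ_nonempty).ne'
  · refine QWhittaker.vecMul_exp_of_vecMul_eq_zero ?_
    rw [Matrix.vecMul_smul, QWhittaker.vecMul_gibbs_generator hm₁ hm₂ hq0 hq1 ha, smul_zero]
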